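/- Let $G$ be a locally compact (Hausdorff) group that is generated by a compact subset, let $\Gamma\le G$ be a cocompact lattice, and let $\Lambda$ be a subgroup of the commensurator $$\mathrm{Comm}_G(\Gamma)=\{g\in G:\ g\Gamma g^{-1}\text{ and }\Gamma\text{ are commensurable}\}$$ such that $\Gamma\subseteq\Lambda$ and $\Lambda$ is dense in $G$. Let $X$ be a complete metric space which is - Busemann non-positively curved (BNPC): $X$ is geodesic and for any two constant speed geodesics $c,c':[0,1]\to X$ the function $t\mapsto d(c(t),c'(t))$ is convex (so any two points $x,y$ have a unique midpoint, written $\frac{x+y}{2}$); and - uniformly convex: for every $\epsilon>0$ there is $\delta>0$ such that for all $r>0$ and all $x,y_1,y_2\in X$ with $d(x,y_1)\le r$, $d(x,y_2)\le r$ and $d(y_1,y_2)\ge\epsilon r$ one has $d\big(x,\frac{y_1+y_2}{2}\big)\le(1-\delta)r$. Call segments $[a,b]$ and $[x,y]$ in $X$ parallel if $d(a,x)=d(b,y)=d\big(\frac{a+b}{2},\frac{x+y}{2}\big)$. For a finite set $\Sigma\subset\Lambda$ acting on $X$ put $d_\Sigma(x)=\max_{\sigma\in\Sigma}d(\sigma\cdot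 x,x)$. Suppose that $\Lambda$ (as an abstract group) acts on $X$ by isometries so that 1. for every subgroup $\Gamma_0\le\Lambda$ commensurable to $\Gamma$ and every finite generating set $\Sigma_0$ of $\Gamma_0$, $d_{\Sigma_0}(x)\to\infty$ as $x$ leaves every ball; 2. every subgroup $\Gamma_0\le\Lambda$ commensurable to $\Gamma$ has no parallel orbits, i.e. for any two distinct points $x,y\in X$ there is $\gamma\in\Gamma_0$ such that $[\gamma\cdot x,\gamma\cdot y]$ and $[x,y]$ are not parallel; 3. the action is $C$-minimal: $X$ has no non-empty proper closed convex $\Lambda$-invariant subset. Then the $\Lambda$-action on $X$ extends uniquely to a continuous isometric $G$-action: there is exactly one action of $G$ on $X$ by isometries for which $G\times X\to X$ is continuous and whose restriction to $\Lambda$ is the given action. -/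

import Mathlib

open Topology Filter Set

section Geometry

variable {X : Type*} [MetricSpace X]

/-- `c`, restricted to `[0,1]`, is a constant speed geodesic segment (possibly of length zero);
the values of `c` outside `[0,1]` are irrelevant. -/
def IsConstSpeedGeodesic (c : ℝ → X) : Prop :=
  ∀ s ∈ Icc (0 : ℝ) 1, ∀ t ∈ Icc (0 : ℝ) 1, dist (c s) (c t) = |s - t| * dist (c 0) (c 1)

/-- `m` is a midpoint of `x` and `y`. In a Busemann non-positively curved space it is unique. -/
def IsMidpoint (m x y : X) : Prop :=
  dist x m = dist x y / 2 ∧ dist m y = dist x y / 2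

/-- A subset is (geodesically) convex if it contains every geodesic segment joining two of its
points. -/
def IsGeodConvex (C : Set X) : Prop :=
  ∀ c : ℝ → X, IsConstSpeedGeodesic c → c 0 ∈ C → c 1 ∈ C → ∀ t ∈ Icc (0 : ℝ) 1, c t ∈ C

/-- The segments `[a,b]` and `[x,y]` are parallel:
`d(a,x) = d(b,y) = d((a+b)/2, (x+y)/2)`, where `(p+q)/2` is the midpoint. -/
def ParallelSegments (a b x y : X) : Prop :=
  dist a x = dist b y ∧ ∃ m n : X, IsMidpoint m a b ∧ IsMidpoint n x y ∧ dist m n = dist a x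

variable (X) in
/-- Busemann non-positive curvature (BNPC), for a metric space that is assumed complete
separately: the space is geodesic, and the distance between any two constant speed geodesics is
a convex function. -/
structure IsBNPC : Prop where
  exists_geodesic : ∀ x y : X, ∃ c : ℝ → X, IsConstSpeedGeodesic c ∧ c 0 = x ∧ c 1 = y
  convexOn_dist : ∀ c c' : ℝ → X, IsConstSpeedGeodesic c → IsConstSpeedGeodesic c' →
    ConvexOn ℝ (Icc (0 : ℝ) 1) (fun t => dist (c t) (c' t))

variable (X) in
/-- Uniform convexity: for every `ε > 0` there is `δ > 0` such that `δ_x(ε,r) ≥ δ r` for all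
`r > 0` and `x`, where `δ_x(ε,r)` is the infimum of `r - d(x, (y₁+y₂)/2)` over all `y₁, y₂` with
`d(x,y_i) ≤ r` and `d(y₁,y₂) ≥ ε r` (the infimum of the empty set being `+∞`). -/
def IsUniformlyConvexSpace : Prop :=
  ∀ ε : ℝ, 0 < ε → ∃ δ : ℝ, 0 < δ ∧ ∀ r : ℝ, 0 < r → ∀ x y₁ y₂ m : X,
    dist x y₁ ≤ r → dist x y₂ ≤ r → ε * r ≤ dist y₁ y₂ → IsMidpoint m y₁ y₂ →
      δ * r ≤ r - dist x m

end Geometry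

section Actions

variable {H X : Type*} [Group H] [MetricSpace X]

/-- The action `α` by isometries is `C`-minimal: there is no non-empty closed convex proper
invariant subset. -/
def IsCMinimal (α : H →* (X ≃ᵢ X)) : Prop :=
  ∀ C : Set X, C.Nonempty → IsClosed C → IsGeodConvex C → (∀ h : H, ∀ x ∈ C, α h x ∈ C) →
    C = univ

/-- The displacement function `d_S(x) = max_{s ∈ S} d(s • x, x)` of a finite set `S`
(zero if `S` is empty). -/
noncomputable def displacement (α : H →* (X ≃ᵢ X)) (S : Finset H) (x : X) : ℝ :=
  ((S.sup fun s => nndist (α s x) x : NNReal) : ℝ)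

/-- `d_S → ∞`: the displacement tends to infinity as `x` eventually leaves every ball. -/
def DisplacementTendsToInfinity (α : H →* (X ≃ᵢ X)) (S : Finset H) : Prop :=
  Tendsto (displacement α S) (Bornology.cobounded X) atTop

/-- The subgroup `K` has no parallel orbits: for distinct `x, y` there is `k ∈ K` such that
`[k • x, k • y]` is not parallel to `[x, y]`. -/
def HasNoParallelOrbits (α : H →* (X ≃ᵢ X)) (K : Subgroup H) : Prop :=
  ∀ x y : X, x ≠ y → ∃ k ∈ K, ¬ ParallelSegments (α k x) (α k y) x y

end Actions

/-- A topological group is compactly generated if it is generated by a compact subset. -/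
def IsCompactlyGeneratedGroup (G : Type*) [Group G] [TopologicalSpace G] : Prop :=
  ∃ K : Set G, IsCompact K ∧ Subgroup.closure K = ⊤

/-- A cocompact lattice: a discrete subgroup with compact quotient space. (In a locally compact
Hausdorff group such a subgroup automatically has finite covolume.) -/
structure IsCocompactLattice {G : Type*} [Group G] [TopologicalSpace G] (Γ : Subgroup G) :
    Prop where
  discrete : DiscreteTopology Γ
  cocompact : CompactSpace (G ⧸ Γ)

/-!
Fix a left Haar measure `ν` on `G` and a positive left-invariant kernel `k` on `G × G`, and assign
to a `Γ`-equivariant measurable map `φ : G → X` the energy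
`E(φ) = ∫_F ∫_G k(g,h) d(φ(g),φ(h))² dh dg`, where `F` is a fundamental domain for `Γ` acting on `G`
by left multiplication. The theorem follows from the existence and uniqueness of energy minimizers
("harmonic maps") for `Γ` and its subgroups of finite index.

*Existence* (`exists_isEnergyMinimizer`). A bound on the energy bounds the displacement of some
value of `φ` under a finite generating set, hence, by properness of the displacement, the distance
of `φ` from a fixed point (`exists_sqDistFrom_le_of_energy_le`). Sublevel sets of `E` are closed
under pointwise midpoints, because the metric of `X` is convex. Among energy-minimizing sequences,
choose one which is also asymptotically closest to the fixed point: uniform convexity makes it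
Cauchy in measure, and Fatou's lemma shows that its limit is a minimizer. The kernel decays so fast
that some equivariant map has finite energy (`exists_isInvariantKernel`).

*Uniqueness* (`IsEnergyMinimizer.ae_eq`). If `φ` and `ψ` are both minimizers, then the segments
`[φ(g), ψ(g)]` and `[φ(h), ψ(h)]` are parallel for almost all `(g, h)`. Parallelism is a closed
relation, so `[x, y]` and `[γ x, γ y]` are parallel for every `(x, y)` in the essential range of
`(φ, ψ)`; as there are no parallel orbits, `x = y`.

*Equivariance under the commensurator* (`IsEnergyMinimizer.ae_map_mul_of_commensurates`). By
uniqueness, a minimizer `φ` for `Γ` is a minimizer for all subgroups of finite index. For `a ∈ Λ`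
both `φ` and `a · φ(a⁻¹ ·)` are therefore minimizers for `Γ ∩ a Γ a⁻¹`, and so they agree almost
everywhere. Left invariance of `ν` and `k` is all that is needed here.

*Continuity* (`tendsto_orbit_of_measure_preimage_ne_zero`, `IsCMinimal.tendsto_orbit`). For a point
`x` in the essential range of the `Λ`-equivariant map `φ`, a Steinhaus-type argument shows that
`a x → x` as `a → 1` in `Λ` with the topology of `G`. The points with this property form a closed
convex `Λ`-invariant set, which is all of `X` by minimality, and the action extends by density and
completeness (`exists_continuous_extension_action`).

As `G` is not assumed second countable, joint measurability of the kernel is a concern; it is dealt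
with by `measurable_comp_inv_mul`. Maps to `X` are strongly measurable, so `X` need not be separable.
-/

/-! ### Midpoints in Busemann non-positively curved spaces -/

section Midpoints

variable {X : Type*} [MetricSpace X]

/-- The midpoint of `x` and `y`: the value at `1 / 2` of a chosen geodesic from `x` to `y`. By
`IsBNPC.eq_mid` it does not depend on the choice. -/
noncomputable def IsBNPC.mid (hX : IsBNPC X) (x y : X) : X :=
  (hX.exists_geodesic x y).choose (1 / 2)

theorem IsConstSpeedGeodesic.const (x : X) : IsConstSpeedGeodesic fun _ : ℝ => x := by
  intro s _ t _; simp

theorem IsConstSpeedGeodesic.map {c : ℝ → X} (hc : IsConstSpeedGeodesic c) (e : X ≃ᵢ X) :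
    IsConstSpeedGeodesic fun t => e (c t) := by
  intro s hs t ht
  simpa only [e.dist_eq] using hc s hs t ht

theorem IsBNPC.dist_half_le (hX : IsBNPC X) {c c' : ℝ → X} (hc : IsConstSpeedGeodesic c)
    (hc' : IsConstSpeedGeodesic c') :
    dist (c (1 / 2)) (c' (1 / 2)) ≤ (dist (c 0) (c' 0) + dist (c 1) (c' 1)) / 2 := by
  have h := (hX.convexOn_dist c c' hc hc').2 (by simp : (0 : ℝ) ∈ Icc (0 : ℝ) 1)
    (by simp : (1 : ℝ) ∈ Icc (0 : ℝ) 1) (by norm_num : (0 : ℝ) ≤ 1 / 2)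
    (by norm_num : (0 : ℝ) ≤ 1 / 2) (by norm_num)
  norm_num at h ⊢
  linarith

theorem IsBNPC.eq_mid (hX : IsBNPC X) {c : ℝ → X} (hc : IsConstSpeedGeodesic c) :
    c (1 / 2) = hX.mid (c 0) (c 1) := by
  have h := (hX.exists_geodesic (c 0) (c 1)).choose_spec
  have := hX.dist_half_le hc h.1
  rw [h.2.1, h.2.2, dist_self, dist_self] at this
  exact dist_le_zero.1 (this.trans (by norm_num))

theorem IsBNPC.isMidpoint_mid (hX : IsBNPC X) (x y : X) : IsMidpoint (hX.mid x y) x y := by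
  obtain ⟨c, hc, rfl, rfl⟩ := hX.exists_geodesic x y
  rw [← hX.eq_mid hc]
  constructor
  · rw [hc 0 (by simp) (1 / 2) (by norm_num)]; norm_num [abs_of_pos]; ring
  · rw [hc (1 / 2) (by norm_num) 1 (by simp)]; norm_num [abs_of_pos]; ring

theorem IsBNPC.dist_mid_mid_le (hX : IsBNPC X) (x y x' y' : X) :
    dist (hX.mid x y) (hX.mid x' y') ≤ (dist x x' + dist y y') / 2 := by
  obtain ⟨c, hc, rfl, rfl⟩ := hX.exists_geodesic x y
  obtain ⟨c', hc', rfl, rfl⟩ := hX.exists_geodesic x' y'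
  rw [← hX.eq_mid hc, ← hX.eq_mid hc']
  exact hX.dist_half_le hc hc'

theorem IsBNPC.map_mid (hX : IsBNPC X) (e : X ≃ᵢ X) (x y : X) :
    e (hX.mid x y) = hX.mid (e x) (e y) := by
  obtain ⟨c, hc, rfl, rfl⟩ := hX.exists_geodesic x y
  rw [← hX.eq_mid hc]
  exact hX.eq_mid (hc.map e)

theorem IsBNPC.mid_self (hX : IsBNPC X) (x : X) : hX.mid x x = x :=
  (hX.eq_mid (IsConstSpeedGeodesic.const x)).symm

theorem IsBNPC.dist_mid_le (hX : IsBNPC X) (p x y : X) :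
    dist p (hX.mid x y) ≤ (dist p x + dist p y) / 2 := by
  simpa only [hX.mid_self] using hX.dist_mid_mid_le p p x y

theorem IsBNPC.continuous_mid (hX : IsBNPC X) :
    Continuous fun p : X × X => hX.mid p.1 p.2 := by
  refine (LipschitzWith.of_dist_le_mul (K := 1) fun p q => ?_).continuous
  have h := hX.dist_mid_mid_le p.1 p.2 q.1 q.2
  rw [Prod.dist_eq, NNReal.coe_one, one_mul]
  linarith [le_max_left (dist p.1 q.1) (dist p.2 q.2), le_max_right (dist p.1 q.1) (dist p.2 q.2)]

/-- The amount by which the square of `q` falls short of the mean square of `a` and `b`. It is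
nonnegative as soon as `q` is at most the mean of `a` and `b`. -/
noncomputable def sqDefect (a b q : ℝ) : ℝ := (a ^ 2 + b ^ 2) / 2 - q ^ 2

theorem sq_sub_div_four_le_sqDefect {a b q : ℝ} (hq : 0 ≤ q) (h : q ≤ (a + b) / 2) :
    (a - b) ^ 2 / 4 ≤ sqDefect a b q := by
  unfold sqDefect
  nlinarith [mul_self_le_mul_self hq h]

theorem sqDefect_nonneg {a b q : ℝ} (hq : 0 ≤ q) (h : q ≤ (a + b) / 2) : 0 ≤ sqDefect a b q :=
  (by positivity : 0 ≤ (a - b) ^ 2 / 4).trans (sq_sub_div_four_le_sqDefect hq h)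

/-- Quantitative strict convexity of the squared distance on bounded sets. -/
theorem IsBNPC.exists_le_sqDefect (hX : IsBNPC X) (hUC : IsUniformlyConvexSpace X) {ε R : ℝ}
    (hε : 0 < ε) (hR : 0 < R) :
    ∃ κ > 0, ∀ p x y : X, dist p x ≤ R → dist p y ≤ R → ε ≤ dist x y →
      κ ≤ sqDefect (dist p x) (dist p y) (dist p (hX.mid x y)) := by
  obtain ⟨δ, hδ, H⟩ := hUC (ε / R) (by positivity)
  -- It suffices to treat `δ ≤ 1`; the two cases below are `|a - b| ≥ δ M / 2` and its negation,
  -- where `M` is the larger of `a = dist p x` and `b = dist p y`, so that `M ≥ ε / 2`.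
  refine ⟨(min δ 1) ^ 2 * (ε / 2) ^ 2 / 16, by positivity, fun p x y hx hy hxy => ?_⟩
  set a := dist p x with ha
  set b := dist p y with hb
  set q := dist p (hX.mid x y) with hq
  set M := max a b with hM
  have hq0 : 0 ≤ q := dist_nonneg
  have hqab : q ≤ (a + b) / 2 := hX.dist_mid_le p x y
  have haM : a ≤ M := le_max_left _ _
  have hbM : b ≤ M := le_max_right _ _
  have hMε : ε / 2 ≤ M := by
    have := dist_triangle_left x y p
    linarith
  have hM0 : 0 < M := by linarith
  have hMR : M ≤ R := max_le hx hy
  have hqM : min δ 1 * M ≤ M - q := by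
    refine (mul_le_mul_of_nonneg_right (min_le_left _ _) hM0.le).trans ?_
    refine H M hM0 p x y _ haM hbM ?_ (hX.isMidpoint_mid x y)
    refine le_trans ?_ hxy
    rw [div_mul_eq_mul_div]
    exact div_le_of_le_mul₀ hR.le hε.le (mul_le_mul_of_nonneg_left hMR hε.le)
  set d := min δ 1 with hd
  have hd0 : 0 < d := lt_min hδ one_pos
  have hd1 : d ≤ 1 := min_le_right _ _
  have hle : d ^ 2 * (ε / 2) ^ 2 / 16 ≤ (d * M) ^ 2 / 16 := by
    rw [mul_pow]
    gcongr
  refine hle.trans ?_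
  by_cases hab : d * M / 2 ≤ |a - b|
  · refine le_trans ?_ (sq_sub_div_four_le_sqDefect hq0 hqab)
    have : (d * M / 2) ^ 2 ≤ |a - b| ^ 2 := by gcongr
    rw [sq_abs] at this
    linarith
  · push Not at hab
    have hlow : M - d * M / 2 ≤ a ∧ M - d * M / 2 ≤ b := by
      rw [abs_lt] at hab
      rcases max_cases a b with h | h <;> constructor <;> linarith [h.1]
    have hdM : d * M ≤ M := by nlinarith
    have hdM0 : 0 < d * M := by positivity
    have h1 : (M - d * M / 2) ^ 2 ≤ a ^ 2 := by
      apply pow_le_pow_left₀ _ hlow.1; linarith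
    have h2 : (M - d * M / 2) ^ 2 ≤ b ^ 2 := by
      apply pow_le_pow_left₀ _ hlow.2; linarith
    have h3 : q ^ 2 ≤ (M - d * M) ^ 2 := by
      apply pow_le_pow_left₀ hq0; linarith
    unfold sqDefect
    nlinarith [mul_le_mul_of_nonneg_left hdM hdM0.le]

end Midpoints

/-! ### Discrete cocompact subgroups and their fundamental domains -/

section Lattices

open Pointwise

variable {G H : Type*} [Group G] [TopologicalSpace G] [Group H]

/-- The subgroup `N` of `H` maps injectively onto a discrete cocompact subgroup of `G`. -/
structure IsDiscreteCocompact (ι : H →* G) (N : Subgroup H) : Prop where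
  discrete : ∃ V ∈ 𝓝 (1 : G), ∀ n ∈ N, ι n ∈ V → n = 1
  cocompact : ∃ C : Set G, IsCompact C ∧ ∀ g, ∃ n ∈ N, ι n * g ∈ C

/-- `F` is a measurable set meeting every orbit of `N`, acting on `G` by left multiplication
through `ι`, in exactly one point, and no such point is reached twice. -/
structure IsStrictFundamentalDomain [MeasurableSpace G] (ι : H →* G) (N : Subgroup H)
    (F : Set G) : Prop where
  measurableSet : MeasurableSet F
  existsUnique : ∀ g, ∃! n, n ∈ N ∧ ι n * g ∈ F

theorem IsCompactlyGeneratedGroup.sigmaCompactSpace [IsTopologicalGroup G]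
    (hG : IsCompactlyGeneratedGroup G) : SigmaCompactSpace G := by
  obtain ⟨K, hK, hgen⟩ := hG
  have hK' : IsCompact (K ∪ K⁻¹) := hK.union hK.inv
  have hpow : ∀ n : ℕ, IsCompact ((K ∪ K⁻¹) ^ n) := fun n => by
    induction n with
    | zero => simp
    | succ n ih => rw [pow_succ]; exact ih.mul hK'
  refine isSigmaCompact_univ_iff.1 ⟨fun n => (K ∪ K⁻¹) ^ n, hpow, ?_⟩
  refine eq_univ_of_forall fun g => ?_
  have hg : g ∈ Subgroup.closure K := hgen ▸ Subgroup.mem_top g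
  induction hg using Subgroup.closure_induction_right with
  | one => exact mem_iUnion.2 ⟨0, by simp⟩
  | mul_right x hx y hy ih =>
    obtain ⟨n, hn⟩ := mem_iUnion.1 ih
    exact mem_iUnion.2 ⟨n + 1, by
      rw [pow_succ]; exact mul_mem_mul hn (Or.inl hy)⟩
  | mul_inv_cancel x hx y hy ih =>
    obtain ⟨n, hn⟩ := mem_iUnion.1 ih
    exact mem_iUnion.2 ⟨n + 1, by
      rw [pow_succ]; exact mul_mem_mul hn (Or.inr (by simpa using hy))⟩

variable [IsTopologicalGroup G] {ι : H →* G} {N : Subgroup H}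

/-- Distinct translates by `N` of a small right-translated neighbourhood are disjoint. -/
theorem IsDiscreteCocompact.exists_small_nhds (hN : IsDiscreteCocompact ι N) :
    ∃ V : Set G, IsOpen V ∧ 1 ∈ V ∧
      ∀ n ∈ N, ∀ m ∈ N, ∀ g x, ι n * x * g ∈ V → ι m * x * g ∈ V → n = m := by
  obtain ⟨U, hU, hUN⟩ := hN.discrete
  obtain ⟨V, hV, hVU⟩ := exists_nhds_split_inv hU
  refine ⟨interior V, isOpen_interior, mem_interior_iff_mem_nhds.2 hV,
    fun n hn m hm g x h1 h2 => ?_⟩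
  have h := hVU _ (interior_subset h1) _ (interior_subset h2)
  have : ι (n * m⁻¹) ∈ U := by
    convert h using 1
    rw [map_mul, map_inv, div_eq_mul_inv]; simp only [mul_inv_rev, mul_assoc, mul_inv_cancel_left]
  exact mul_inv_eq_one.1 (hUN _ (N.mul_mem hn (N.inv_mem hm)) this)

theorem IsDiscreteCocompact.finite_inter (hN : IsDiscreteCocompact ι N) {K : Set G}
    (hK : IsCompact K) : {n | n ∈ N ∧ ι n ∈ K}.Finite := by
  obtain ⟨V, hVo, hV1, hV⟩ := hN.exists_small_nhds
  obtain ⟨t, -, ht⟩ := hK.elim_nhds_subcover (fun g => {x | x * g⁻¹ ∈ V}) fun g _ =>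
    (hVo.preimage (continuous_mul_const g⁻¹)).mem_nhds (by simpa using hV1)
  refine (t.finite_toSet.biUnion (t := fun g => {n | n ∈ N ∧ ι n * g⁻¹ ∈ V})
    fun g _ => Set.Subsingleton.finite ?_).subset ?_
  · intro n hn m hm
    exact hV n hn.1 m hm.1 g⁻¹ 1 (by simpa using hn.2) (by simpa using hm.2)
  · intro n hn
    obtain ⟨g, hg, hng⟩ := mem_iUnion₂.1 (ht hn.2)
    exact mem_iUnion₂.2 ⟨g, hg, hn.1, hng⟩

theorem IsDiscreteCocompact.countable [SigmaCompactSpace G] (hN : IsDiscreteCocompact ι N) :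
    Countable N := by
  have : (N : Set H) = ⋃ k, {n | n ∈ N ∧ ι n ∈ compactCovering G k} := by
    ext n
    simp only [SetLike.mem_coe, mem_iUnion, mem_ofPred_eq]
    exact ⟨fun h => (exists_mem_compactCovering (ι n)).imp fun k hk => ⟨h, hk⟩,
      fun ⟨k, hk⟩ => hk.1⟩
  have h : (N : Set H).Countable := by
    rw [this]
    exact countable_iUnion fun k => (hN.finite_inter (isCompact_compactCovering G k)).countable
  exact h.to_subtype

theorem IsDiscreteCocompact.of_finite_relIndex {Γ : Subgroup H} (hΓ : IsDiscreteCocompact ι Γ)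
    (hN : N ≤ Γ) (hi : N.relIndex Γ ≠ 0) : IsDiscreteCocompact ι N := by
  obtain ⟨V, hV, hVΓ⟩ := hΓ.discrete
  obtain ⟨C, hC, hCΓ⟩ := hΓ.cocompact
  refine ⟨⟨V, hV, fun n hn => hVΓ n (hN hn)⟩, ?_⟩
  have : Finite (Γ ⧸ N.subgroupOf Γ) := 
    @Subgroup.finite_quotient_of_finiteIndex _ _ _ ⟨hi⟩
  refine ⟨⋃ q : Γ ⧸ N.subgroupOf Γ, (fun g => ι (q.out : H)⁻¹ * g) '' C,
    isCompact_iUnion fun q => hC.image (continuous_const_mul _), fun g => ?_⟩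
  obtain ⟨γ, hγ, hγC⟩ := hCΓ g
  let q : Γ ⧸ N.subgroupOf Γ := QuotientGroup.mk ⟨γ, hγ⟩
  have hq : (q.out)⁻¹ * (⟨γ, hγ⟩ : Γ) ∈ N.subgroupOf Γ :=
    QuotientGroup.eq.1 (Quotient.out_eq' q)
  refine ⟨(q.out : H)⁻¹ * γ, Subgroup.mem_subgroupOf.1 hq, mem_iUnion.2 ⟨q, _, hγC, ?_⟩⟩
  simp only [map_mul, mul_assoc]

/-- Finite generation: if `M` is the subgroup generated by the elements `S` below, then `M C` is
invariant under right multiplication by the generators `K` of `G`, so it is the whole group. -/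
theorem IsDiscreteCocompact.exists_closure_eq (hN : IsDiscreteCocompact ι N)
    (hG : IsCompactlyGeneratedGroup G) : ∃ S : Finset H, Subgroup.closure (S : Set H) = N := by
  obtain ⟨K, hK, hgen⟩ := hG
  obtain ⟨C₀, hC₀, hCN₀⟩ := hN.cocompact
  set C := insert 1 C₀ with hCdef
  have hC : IsCompact C := hC₀.insert 1
  have hCN : ∀ g, ∃ n ∈ N, ι n * g ∈ C := fun g =>
    (hCN₀ g).imp fun n hn => ⟨hn.1, Or.inr hn.2⟩
  -- The elements moving the fundamental region `C` to an adjacent one, together with those which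
  -- already lie in `C`.
  have hfin := hN.finite_inter (((hC.mul (hK.union hK.inv)).mul hC.inv).union hC)
  refine ⟨hfin.toFinset, ?_⟩
  rw [Finite.coe_toFinset]
  set S := {n | n ∈ N ∧ ι n ∈ C * (K ∪ K⁻¹) * C⁻¹ ∪ C} with hS
  have hSN : Subgroup.closure S ≤ N := (Subgroup.closure_le _).2 fun n hn => hn.1
  have step : ∀ g k, k ∈ K ∪ K⁻¹ → (∃ m ∈ Subgroup.closure S, ι m * g ∈ C) →
      ∃ m ∈ Subgroup.closure S, ι m * (g * k) ∈ C := by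
    rintro g k hk ⟨m, hm, hmg⟩
    obtain ⟨n, hn, hnC⟩ := hCN (ι m * g * k)
    have hk' : k⁻¹ ∈ K ∪ K⁻¹ := by
      rcases hk with hk | hk
      · exact Or.inr (by simpa using hk)
      · exact Or.inl hk
    have hnS : n ∈ S := by
      refine ⟨hn, Or.inl ?_⟩
      refine ⟨ι n * (ι m * g * k) * k⁻¹, ⟨_, hnC, _, hk', rfl⟩, (ι m * g)⁻¹,
        by simpa using hmg, ?_⟩
      simp only []
      group
    refine ⟨n * m, mul_mem (Subgroup.subset_closure hnS) hm, ?_⟩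
    simpa only [map_mul, mul_assoc] using hnC
  have all : ∀ g : G, ∃ m ∈ Subgroup.closure S, ι m * g ∈ C := by
    intro g
    have hg : g ∈ Subgroup.closure K := hgen ▸ Subgroup.mem_top g
    induction hg using Subgroup.closure_induction_right with
    | one => exact ⟨1, one_mem _, by simp [hCdef]⟩
    | mul_right x hx y hy ih => exact step x y (Or.inl hy) ih
    | mul_inv_cancel x hx y hy ih => exact step x y⁻¹ (Or.inr (by simpa using hy)) ih
  refine le_antisymm hSN fun n hn => ?_
  obtain ⟨m, hm, hmn⟩ := all (ι n)
  have : m * n ∈ S := ⟨N.mul_mem (hSN hm) hn, Or.inr (by simpa using hmn)⟩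
  simpa using mul_mem (inv_mem hm) (Subgroup.subset_closure this)

/-- A relatively compact fundamental domain: cover a compact set meeting all orbits by finitely many
open sets with disjoint translates, and remove from each the orbits of the preceding ones. -/
theorem IsDiscreteCocompact.exists_fundamentalDomain [LocallyCompactSpace G] [MeasurableSpace G]
    [BorelSpace G] (hN : IsDiscreteCocompact ι N) :
    ∃ F C : Set G, IsStrictFundamentalDomain ι N F ∧ IsCompact C ∧ F ⊆ C := by
  obtain ⟨V₀, hV₀o, hV₀1, hV₀⟩ := hN.exists_small_nhds
  obtain ⟨K₀, hK₀, hK₀1⟩ := exists_compact_mem_nhds (1 : G)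
  set V := V₀ ∩ interior K₀ with hVdef
  have hVo : IsOpen V := hV₀o.inter isOpen_interior
  have hV1 : (1 : G) ∈ V := ⟨hV₀1, mem_interior_iff_mem_nhds.2 hK₀1⟩
  obtain ⟨C, hC, hCN⟩ := hN.cocompact
  obtain ⟨t, -, ht⟩ := hC.elim_nhds_subcover (fun g => {x | x * g⁻¹ ∈ V}) fun g _ =>
    (hVo.preimage (continuous_mul_const g⁻¹)).mem_nhds (by simpa using hV1)
  let u : Fin t.card → G := fun i => t.equivFin.symm i
  -- The saturation of the `i`-th piece of the cover.
  let sat : Fin t.card → Set G := fun i => {x | ∃ n ∈ N, ι n * x * (u i)⁻¹ ∈ V}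
  have hpiece : ∀ i, IsOpen {x | x * (u i)⁻¹ ∈ V} := fun i =>
    hVo.preimage (continuous_mul_const _)
  have hsat : ∀ i, IsOpen (sat i) := fun i => by
    have : sat i = ⋃ n ∈ N, {x | ι n * x * (u i)⁻¹ ∈ V} := by ext x; simp [sat]
    rw [this]
    exact isOpen_biUnion fun n _ =>
      hVo.preimage ((continuous_mul_const _).comp (continuous_const_mul (ι n)))
  have hsat_inv : ∀ i x, ∀ m ∈ N, ι m * x ∈ sat i ↔ x ∈ sat i := by
    intro i x m hm
    constructor
    · rintro ⟨n, hn, h⟩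
      exact ⟨n * m, N.mul_mem hn hm, by simpa only [map_mul, mul_assoc] using h⟩
    · rintro ⟨n, hn, h⟩
      refine ⟨n * m⁻¹, N.mul_mem hn (N.inv_mem hm), ?_⟩
      simpa only [map_mul, map_inv, mul_assoc, inv_mul_cancel_left] using h
  refine ⟨⋃ i, ({x | x * (u i)⁻¹ ∈ V} ∩ ⋂ j, ⋂ (_ : j < i), (sat j)ᶜ),
    ⋃ i, (fun x => x * u i) '' K₀, ⟨?_, fun g => ?_⟩,
    isCompact_iUnion fun i => hK₀.image (continuous_mul_const _), ?_⟩
  · exact MeasurableSet.iUnion fun i => (hpiece i).measurableSet.inter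
      (MeasurableSet.iInter fun j => MeasurableSet.iInter fun _ => (hsat j).measurableSet.compl)
  · have hex : ∃ i, g ∈ sat i := by
      obtain ⟨n, hn, hnC⟩ := hCN g
      obtain ⟨c, hc, hcV⟩ := mem_iUnion₂.1 (ht hnC)
      exact ⟨t.equivFin ⟨c, hc⟩, n, hn, by simpa [u] using hcV⟩
    obtain ⟨i, hi, hmin⟩ : ∃ i, g ∈ sat i ∧ ∀ j < i, g ∉ sat j := by
      classical
      have hne : (Finset.univ.filter fun i => g ∈ sat i).Nonempty := by
        obtain ⟨i, hi⟩ := hex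
        exact ⟨i, by simpa using hi⟩
      refine ⟨_, (Finset.mem_filter.1 (Finset.min'_mem _ hne)).2, fun j hj hjs => ?_⟩
      exact absurd (Finset.min'_le _ j (by simpa using hjs)) (not_le.2 hj)
    have hchar : ∀ n ∈ N, (ι n * g ∈ ⋃ i, ({x | x * (u i)⁻¹ ∈ V} ∩
        ⋂ j, ⋂ (_ : j < i), (sat j)ᶜ)) ↔ ι n * g * (u i)⁻¹ ∈ V := by
      intro n hn
      simp only [mem_iUnion, mem_inter_iff, mem_ofPred_eq, mem_iInter, mem_compl_iff,
        hsat_inv _ g n hn]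
      constructor
      · rintro ⟨i', hi', hlt⟩
        have h1 : ¬ i < i' := fun h => hlt i h hi
        have h2 : ¬ i' < i := fun h => hmin i' h ⟨n, hn, hi'⟩
        rwa [le_antisymm (not_lt.1 h2) (not_lt.1 h1)]
      · exact fun h => ⟨i, h, hmin⟩
    obtain ⟨n, hn, hnV⟩ := hi
    refine ⟨n, ⟨hn, (hchar n hn).2 hnV⟩, fun m hm => ?_⟩
    exact hV₀ m hm.1 n hn _ _ ((hchar m hm.1).1 hm.2).1 hnV.1
  · refine iUnion_mono fun i x hx => ⟨x * (u i)⁻¹, interior_subset hx.1.2, by simp⟩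

end Lattices

/-! ### Equivariant maps and their energy -/

section Energy

open MeasureTheory
open scoped ENNReal

/-- Almost every value of a strongly measurable map lies in its essential range. -/
theorem MeasureTheory.StronglyMeasurable.ae_measure_preimage_ne_zero {Ω Y : Type*}
    [MeasurableSpace Ω] [PseudoMetricSpace Y] (μ : Measure Ω) {f : Ω → Y}
    (hf : StronglyMeasurable f) : ∀ᵐ ω ∂μ, ∀ U ∈ 𝓝 (f ω), μ (f ⁻¹' U) ≠ 0 := by
  obtain ⟨c, hc, hfc⟩ := hf.isSeparable_range
  have hnull : μ (⋃ y ∈ c, ⋃ n : ℕ, ⋃ (_ : μ (f ⁻¹' Metric.ball y (1 / (n + 1))) = 0),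
      f ⁻¹' Metric.ball y (1 / (n + 1))) = 0 := by
    refine (measure_biUnion_null_iff hc).2 fun y _ => measure_iUnion_null fun n =>
      measure_iUnion_null fun h => h
  refine measure_mono_null (fun ω hω => ?_) hnull
  simp only [mem_compl_iff, mem_ofPred_eq, not_forall, not_not] at hω
  obtain ⟨U, hU, hU0⟩ := hω
  obtain ⟨ε, hε, hεU⟩ := Metric.mem_nhds_iff.1 hU
  obtain ⟨n, hn⟩ := exists_nat_one_div_lt (half_pos hε)
  obtain ⟨y, hy, hyω⟩ := Metric.mem_closure_iff.1 (hfc (mem_range_self ω)) (1 / (n + 1))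
    Nat.one_div_pos_of_nat
  refine mem_iUnion₂.2 ⟨y, hy, mem_iUnion₂.2 ⟨n, ?_, hyω⟩⟩
  refine measure_mono_null (preimage_mono fun z hz => hεU ?_) hU0
  have h1 : dist z y < 1 / (n + 1) := hz
  have h2 : dist (f ω) y < 1 / (n + 1) := hyω
  have h3 := dist_triangle_right z (f ω) y
  exact Metric.mem_ball.2 (by linarith)

variable {G H X : Type*} [Group G] [MeasurableSpace G] [Group H] [MetricSpace X]

/-- The map `φ : G → X` is strongly measurable and, for each `n` in `N`, intertwines almost
everywhere left multiplication by `ι n` with the isometry `α n`. -/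
structure IsAEEquivariant (ι : H →* G) (α : H →* (X ≃ᵢ X)) (ν : Measure G) (N : Subgroup H)
    (φ : G → X) : Prop where
  stronglyMeasurable : StronglyMeasurable φ
  ae_map_mul : ∀ n ∈ N, ∀ᵐ g ∂ν, φ (ι n * g) = α n (φ g)

/-- A positive finite left-invariant kernel, measurable for the product σ-algebra. -/
structure IsInvariantKernel (k : G → G → ℝ≥0∞) : Prop where
  measurable : Measurable (Function.uncurry k)
  ne_zero : ∀ g h, k g h ≠ 0
  ne_top : ∀ g h, k g h ≠ ∞
  map_mul_mul : ∀ a g h, k (a * g) (a * h) = k g h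

/-- The energy density `k(g,h) d(φ(g),φ(h))²`. -/
noncomputable def energyDensity (k : G → G → ℝ≥0∞) (φ : G → X) (p : G × G) : ℝ≥0∞ :=
  k p.1 p.2 * ENNReal.ofReal (dist (φ p.1) (φ p.2) ^ 2)

/-- The energy `∫_F ∫_G k(g,h) d(φ(g),φ(h))² dh dg` of `φ` over the region `F`. -/
noncomputable def energy (ν : Measure G) (k : G → G → ℝ≥0∞) (F : Set G) (φ : G → X) : ℝ≥0∞ :=
  ∫⁻ g in F, ∫⁻ h, energyDensity k φ (g, h) ∂ν ∂ν

/-- `φ` is `N`-equivariant, has finite energy over every fundamental domain of `N`, and this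
energy is least among all `N`-equivariant maps. -/
structure IsEnergyMinimizer (ι : H →* G) (α : H →* (X ≃ᵢ X)) (ν : Measure G)
    (k : G → G → ℝ≥0∞) (N : Subgroup H) (φ : G → X) : Prop
    extends IsAEEquivariant ι α ν N φ where
  energy_ne_top : ∀ F, IsStrictFundamentalDomain ι N F → energy ν k F φ ≠ ∞
  energy_le : ∀ F, IsStrictFundamentalDomain ι N F → ∀ ψ, IsAEEquivariant ι α ν N ψ →
    energy ν k F φ ≤ energy ν k F ψ

variable {ι : H →* G} {α : H →* (X ≃ᵢ X)} {ν : Measure G} {k : G → G → ℝ≥0∞}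
  {N Γ : Subgroup H} {F F' : Set G} {φ ψ : G → X}

theorem IsAEEquivariant.mono (hφ : IsAEEquivariant ι α ν Γ φ) (h : N ≤ Γ) :
    IsAEEquivariant ι α ν N φ :=
  ⟨hφ.1, fun n hn => hφ.2 n (h hn)⟩

theorem IsAEEquivariant.mid (hX : IsBNPC X) (hφ : IsAEEquivariant ι α ν N φ)
    (hψ : IsAEEquivariant ι α ν N ψ) :
    IsAEEquivariant ι α ν N fun g => hX.mid (φ g) (ψ g) := by
  refine ⟨hX.continuous_mid.comp_stronglyMeasurable (hφ.1.prodMk hψ.1), fun n hn => ?_⟩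
  filter_upwards [hφ.2 n hn, hψ.2 n hn] with g h1 h2
  rw [h1, h2, hX.map_mid]

theorem measurable_energyDensity (hk : IsInvariantKernel k) (hφ : StronglyMeasurable φ) :
    Measurable (energyDensity k φ) := by
  refine hk.measurable.mul (ENNReal.measurable_ofReal.comp (Measurable.pow_const ?_ 2))
  exact ((hφ.comp_measurable measurable_fst).dist (hφ.comp_measurable measurable_snd)).measurable

theorem energy_eq_lintegral_prod [SFinite ν] (hk : IsInvariantKernel k)
    (hφ : StronglyMeasurable φ) :
    energy ν k F φ = ∫⁻ p, energyDensity k φ p ∂((ν.restrict F).prod ν) :=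
  (lintegral_prod _ (measurable_energyDensity hk hφ).aemeasurable).symm

theorem ofReal_sq_add_ofReal_sqDefect {a b q : ℝ} (hq : 0 ≤ q) (h : q ≤ (a + b) / 2) :
    ENNReal.ofReal (q ^ 2) + ENNReal.ofReal (sqDefect a b q) =
      2⁻¹ * (ENNReal.ofReal (a ^ 2) + ENNReal.ofReal (b ^ 2)) := by
  have h2 : (2⁻¹ : ℝ≥0∞) = ENNReal.ofReal 2⁻¹ := by
    rw [ENNReal.ofReal_inv_of_pos two_pos, ENNReal.ofReal_ofNat]
  rw [← ENNReal.ofReal_add (by positivity) (sqDefect_nonneg hq h),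
    ← ENNReal.ofReal_add (by positivity) (by positivity), h2,
    ← ENNReal.ofReal_mul (by norm_num)]
  congr 1
  unfold sqDefect
  ring

/-- The parallelogram-type identity for the energy of a midpoint map. -/
theorem energy_mid_add [SFinite ν] (hX : IsBNPC X) (hk : IsInvariantKernel k)
    (hφ : StronglyMeasurable φ) (hψ : StronglyMeasurable ψ) :
    energy ν k F (fun g => hX.mid (φ g) (ψ g)) +
      ∫⁻ p, k p.1 p.2 * ENNReal.ofReal (sqDefect (dist (φ p.1) (φ p.2)) (dist (ψ p.1) (ψ p.2))
        (dist (hX.mid (φ p.1) (ψ p.1)) (hX.mid (φ p.2) (ψ p.2)))) ∂((ν.restrict F).prod ν) =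
    2⁻¹ * (energy ν k F φ + energy ν k F ψ) := by
  have hm : StronglyMeasurable fun g => hX.mid (φ g) (ψ g) :=
    hX.continuous_mid.comp_stronglyMeasurable (hφ.prodMk hψ)
  rw [energy_eq_lintegral_prod hk hφ, energy_eq_lintegral_prod hk hψ,
    energy_eq_lintegral_prod hk hm, ← lintegral_add_left (measurable_energyDensity hk hm),
    ← lintegral_add_left (measurable_energyDensity hk hφ), ← lintegral_const_mul' _ _ (by simp)]
  refine lintegral_congr fun p => ?_
  unfold energyDensity
  rw [← mul_add, ofReal_sq_add_ofReal_sqDefect dist_nonneg (hX.dist_mid_mid_le _ _ _ _)]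
  ring

theorem energy_mid_le [SFinite ν] (hX : IsBNPC X) (hk : IsInvariantKernel k)
    (hφ : StronglyMeasurable φ) (hψ : StronglyMeasurable ψ) {A : ℝ≥0∞}
    (h1 : energy ν k F φ ≤ A) (h2 : energy ν k F ψ ≤ A) :
    energy ν k F (fun g => hX.mid (φ g) (ψ g)) ≤ A := by
  calc _ ≤ 2⁻¹ * (energy ν k F φ + energy ν k F ψ) := by
        rw [← energy_mid_add hX hk hφ hψ]; exact le_self_add
    _ ≤ 2⁻¹ * (A + A) := by gcongr
    _ = A := by
        rw [← two_mul, ← mul_assoc, ENNReal.inv_mul_cancel two_ne_zero ENNReal.ofNat_ne_top,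
          one_mul]

/-- Every `Γ`-orbit meets a fundamental domain of the subgroup `N` exactly `[Γ : N]` times. -/
theorem IsStrictFundamentalDomain.tsum_indicator (hF' : IsStrictFundamentalDomain ι N F')
    (hN : N ≤ Γ) (hi : N.relIndex Γ ≠ 0) (g : G) :
    ∑' γ : Γ, F'.indicator (1 : G → ℝ≥0∞) (ι (γ : H)⁻¹ * g) = N.relIndex Γ := by
  have : Finite (Γ ⧸ N.subgroupOf Γ) := @Subgroup.finite_quotient_of_finiteIndex _ _ _ ⟨hi⟩
  let A : Set Γ := {γ | ι (γ : H)⁻¹ * g ∈ F'}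
  have h1 : ∀ γ : Γ, F'.indicator (1 : G → ℝ≥0∞) (ι (γ : H)⁻¹ * g) =
      A.indicator (fun _ => (1 : ℝ≥0∞)) γ := fun γ => by
    by_cases h : ι (γ : H)⁻¹ * g ∈ F' <;> simp [A, indicator]
  -- Each coset of `N` in `Γ` contains exactly one element of `A`.
  have hbij : Function.Bijective fun a : A => (QuotientGroup.mk (a : Γ) : Γ ⧸ N.subgroupOf Γ) := by
    constructor
    · rintro ⟨a, ha⟩ ⟨b, hb⟩ hab
      have hab' : (a : H)⁻¹ * b ∈ N := Subgroup.mem_subgroupOf.1 (QuotientGroup.eq.1 hab)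
      obtain ⟨n, -, huniq⟩ := hF'.existsUnique (ι (b : H)⁻¹ * g)
      have e1 := huniq 1 ⟨N.one_mem, by simpa [A] using hb⟩
      have e2 := huniq _ ⟨hab', by
        rw [← mul_assoc, ← map_mul, mul_assoc, mul_inv_cancel, mul_one]; exact ha⟩
      exact Subtype.ext (Subtype.ext (inv_mul_eq_one.1 (e2.trans e1.symm)))
    · intro q
      obtain ⟨γ, rfl⟩ := QuotientGroup.mk_surjective q
      obtain ⟨n, ⟨hn, hnF⟩, -⟩ := hF'.existsUnique (ι (γ : H)⁻¹ * g)
      refine ⟨⟨γ * ⟨n, hN hn⟩⁻¹, ?_⟩, ?_⟩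
      · simpa [A, mul_assoc] using hnF
      · refine (QuotientGroup.eq.2 ?_).symm
        simpa [Subgroup.mem_subgroupOf] using hn
  rw [tsum_congr h1, ← tsum_subtype A fun _ => (1 : ℝ≥0∞), ENNReal.tsum_const,
    ENat.card_congr (Equiv.ofBijective _ hbij), mul_one, ENat.card_eq_coe_natCard]
  rfl

variable [MeasurableMul G]

theorem IsStrictFundamentalDomain.lintegral_eq_tsum [ν.IsMulLeftInvariant] [Countable N]
    (hF : IsStrictFundamentalDomain ι N F) {f : G → ℝ≥0∞} (hf : Measurable f) :
    ∫⁻ g, f g ∂ν = ∑' n : N, ∫⁻ g in F, f (ι (n : H)⁻¹ * g) ∂ν := by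
  have hpt : ∀ g, f g = ∑' n : N, F.indicator (fun x => f (ι (n : H)⁻¹ * x)) (ι n * g) := by
    intro g
    obtain ⟨n, ⟨hn, hnF⟩, huniq⟩ := hF.existsUnique g
    rw [tsum_eq_single (⟨n, hn⟩ : N)]
    · simp [indicator_of_mem hnF]
    · intro m hm
      refine indicator_of_notMem (fun h => hm ?_) _
      exact Subtype.ext (huniq m ⟨m.2, h⟩)
  rw [lintegral_congr hpt]
  have hmeas : ∀ n : N, Measurable (F.indicator fun x => f (ι (n : H)⁻¹ * x)) := fun n =>
    (hf.comp (measurable_const_mul _)).indicator hF.measurableSet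
  refine (lintegral_tsum fun n : N =>
    ((hmeas n).comp (measurable_const_mul (ι n))).aemeasurable).trans (tsum_congr fun n => ?_)
  refine (lintegral_mul_left_eq_self (μ := ν) (F.indicator fun x => f (ι (n : H)⁻¹ * x)) (ι n)).trans ?_
  rw [lintegral_indicator hF.measurableSet]

theorem ae_comp_mul_left [ν.IsMulLeftInvariant] (a : G) {p : G → Prop} (h : ∀ᵐ g ∂ν, p g) :
    ∀ᵐ g ∂ν, p (a * g) :=
  (measurePreserving_mul_left ν a).quasiMeasurePreserving.ae h

/-- A property invariant under `N` holds almost everywhere once it does so on a fundamental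
domain. -/
theorem IsStrictFundamentalDomain.ae_of_ae_restrict [ν.IsMulLeftInvariant] [Countable N]
    (hF : IsStrictFundamentalDomain ι N F) {p : G → Prop} (hp : ∀ᵐ g ∂ν.restrict F, p g)
    (hinv : ∀ n ∈ N, ∀ᵐ g ∂ν, p (ι n * g) → p g) : ∀ᵐ g ∂ν, p g := by
  rw [ae_restrict_iff' hF.measurableSet] at hp
  have h1 : ∀ᵐ g ∂ν, ∀ n : N, ι n * g ∈ F → p (ι n * g) :=
    ae_all_iff.2 fun n => ae_comp_mul_left (ι n) hp
  have h2 : ∀ᵐ g ∂ν, ∀ n : N, p (ι n * g) → p g := ae_all_iff.2 fun n => hinv n n.2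
  filter_upwards [h1, h2] with g h1 h2
  obtain ⟨n, ⟨hn, hnF⟩, -⟩ := hF.existsUnique g
  exact h2 ⟨n, hn⟩ (h1 ⟨n, hn⟩ hnF)

theorem IsStrictFundamentalDomain.measure_ne_zero [ν.IsMulLeftInvariant] [NeZero ν] [Countable N]
    (hF : IsStrictFundamentalDomain ι N F) : ν F ≠ 0 := by
  intro h0
  have h := hF.ae_of_ae_restrict (ν := ν) (p := fun _ => False)
    (by rw [Measure.restrict_eq_zero.2 h0]; simp) (by simp)
  exact NeZero.ne ν (ae_eq_bot.1 (eventually_false_iff_eq_bot.1 h))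

/-- Integrals of `Γ`-invariant functions over a fundamental domain are multiplied by the index on
passing to a subgroup. -/
theorem IsStrictFundamentalDomain.setLIntegral_eq_relIndex_mul [ν.IsMulLeftInvariant]
    [Countable Γ] (hF' : IsStrictFundamentalDomain ι N F') (hF : IsStrictFundamentalDomain ι Γ F)
    (hN : N ≤ Γ) (hi : N.relIndex Γ ≠ 0) {f : G → ℝ≥0∞} (hf : Measurable f)
    (hinv : ∀ γ ∈ Γ, ∀ᵐ g ∂ν, f (ι γ * g) = f g) :
    ∫⁻ g in F', f g ∂ν = N.relIndex Γ * ∫⁻ g in F, f g ∂ν := by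
  have hone : Measurable (F'.indicator (1 : G → ℝ≥0∞)) :=
    measurable_one.indicator hF'.measurableSet
  rw [← lintegral_indicator hF'.measurableSet,
    hF.lintegral_eq_tsum (hf.indicator hF'.measurableSet)]
  calc ∑' n : Γ, ∫⁻ g in F, F'.indicator f (ι (n : H)⁻¹ * g) ∂ν
      = ∑' n : Γ, ∫⁻ g in F, F'.indicator 1 (ι (n : H)⁻¹ * g) * f g ∂ν := by
        refine tsum_congr fun n => lintegral_congr_ae (ae_restrict_of_ae ?_)
        filter_upwards [hinv _ (Γ.inv_mem n.2)] with g hg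
        by_cases h : ι (n : H)⁻¹ * g ∈ F'
        · rw [indicator_of_mem h, indicator_of_mem h, hg, Pi.one_apply, one_mul]
        · rw [indicator_of_notMem h, indicator_of_notMem h, zero_mul]
    _ = ∫⁻ g in F, ∑' n : Γ, F'.indicator 1 (ι (n : H)⁻¹ * g) * f g ∂ν :=
        (lintegral_tsum fun n =>
          ((hone.comp (measurable_const_mul _)).mul hf).aemeasurable).symm
    _ = ∫⁻ g in F, N.relIndex Γ * f g ∂ν := by
        refine lintegral_congr fun g => ?_
        rw [ENNReal.tsum_mul_right, hF'.tsum_indicator hN hi]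
    _ = N.relIndex Γ * ∫⁻ g in F, f g ∂ν := lintegral_const_mul _ hf

theorem IsAEEquivariant.ae_lintegral_energyDensity_eq [ν.IsMulLeftInvariant]
    (hk : IsInvariantKernel k) (hφ : IsAEEquivariant ι α ν N φ) {n : H} (hn : n ∈ N) :
    ∀ᵐ g ∂ν, ∫⁻ h, energyDensity k φ (ι n * g, h) ∂ν = ∫⁻ h, energyDensity k φ (g, h) ∂ν := by
  filter_upwards [hφ.2 n hn] with g hg
  rw [← lintegral_mul_left_eq_self _ (ι n)]
  refine lintegral_congr_ae ?_
  filter_upwards [hφ.2 n hn] with h hh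
  simp only [energyDensity, hk.map_mul_mul, hg, hh, IsometryEquiv.dist_eq]

theorem IsAEEquivariant.energy_eq_relIndex_mul [ν.IsMulLeftInvariant] [SFinite ν] [Countable Γ]
    (hk : IsInvariantKernel k) (hφ : IsAEEquivariant ι α ν Γ φ)
    (hF' : IsStrictFundamentalDomain ι N F') (hF : IsStrictFundamentalDomain ι Γ F)
    (hN : N ≤ Γ) (hi : N.relIndex Γ ≠ 0) :
    energy ν k F' φ = N.relIndex Γ * energy ν k F φ :=
  hF'.setLIntegral_eq_relIndex_mul hF hN hi
    (measurable_energyDensity hk hφ.1).lintegral_prod_right'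
    fun _ hγ => hφ.ae_lintegral_energyDensity_eq hk hγ

/-- It suffices to test minimality over a single fundamental domain. -/
theorem IsAEEquivariant.isEnergyMinimizer [ν.IsMulLeftInvariant] [SFinite ν] [Countable N]
    (hk : IsInvariantKernel k) (hφ : IsAEEquivariant ι α ν N φ)
    (hF : IsStrictFundamentalDomain ι N F) (hfin : energy ν k F φ ≠ ∞)
    (hle : ∀ ψ, IsAEEquivariant ι α ν N ψ → energy ν k F φ ≤ energy ν k F ψ) :
    IsEnergyMinimizer ι α ν k N φ := by
  have key : ∀ ψ, IsAEEquivariant ι α ν N ψ → ∀ F', IsStrictFundamentalDomain ι N F' →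
      energy ν k F' ψ = energy ν k F ψ := fun ψ hψ F' hF' => by
    simpa using hψ.energy_eq_relIndex_mul hk hF' hF le_rfl (by simp)
  refine ⟨hφ, fun F' hF' => ?_, fun F' hF' ψ hψ => ?_⟩
  · rwa [key φ hφ F' hF']
  · rw [key φ hφ F' hF', key ψ hψ F' hF']
    exact hle ψ hψ

end Energy

/-! ### Translates of energy minimizers -/

section Translate

variable {G H X : Type*} [Group G] [Group H] [MetricSpace X] {ι : H →* G} {α : H →* (X ≃ᵢ X)}

/-- The translate `g ↦ a · φ(a⁻¹ g)` of `φ` by `a`. -/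
def leftTranslate (ι : H →* G) (α : H →* (X ≃ᵢ X)) (a : H) (φ : G → X) (g : G) : X :=
  α a (φ (ι a⁻¹ * g))

theorem leftTranslate_leftTranslate_inv (a : H) (φ : G → X) :
    leftTranslate ι α a (leftTranslate ι α a⁻¹ φ) = φ := by
  ext g
  simp [leftTranslate, ← mul_assoc, ← IsometryEquiv.mul_apply]

end Translate

/-! ### Uniqueness of energy minimizers -/

section Uniqueness

open MeasureTheory
open scoped ENNReal

variable {G H X : Type*} [Group G] [MeasurableSpace G] [Group H] [MetricSpace X]
  {ι : H →* G} {α : H →* (X ≃ᵢ X)} {ν : Measure G} {k : G → G → ℝ≥0∞}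
  {N N' Γ Γ₀ : Subgroup H} {F F' : Set G} {φ ψ : G → X}

theorem eq_and_eq_of_sqDefect_nonpos {a b q : ℝ} (ha : 0 ≤ a) (hq : 0 ≤ q)
    (hqab : q ≤ (a + b) / 2) (h : sqDefect a b q ≤ 0) : a = b ∧ q = a := by
  have h1 := sq_sub_div_four_le_sqDefect hq hqab
  have hab : a = b := by
    have : (a - b) ^ 2 = 0 := le_antisymm (by linarith) (sq_nonneg _)
    exact sub_eq_zero.1 (pow_eq_zero_iff two_ne_zero |>.1 this)
  subst hab
  refine ⟨rfl, le_antisymm (by linarith) ?_⟩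
  unfold sqDefect at h
  exact (sq_le_sq₀ ha hq).1 (by linarith)

/-- `[P.1, P.2]` and `[Q.1, Q.2]` are parallel, with the canonical midpoints. -/
def IsBNPC.ParallelPairs (hX : IsBNPC X) (P Q : X × X) : Prop :=
  dist P.1 Q.1 = dist P.2 Q.2 ∧ dist (hX.mid P.1 P.2) (hX.mid Q.1 Q.2) = dist P.1 Q.1

theorem IsBNPC.ParallelPairs.parallelSegments {hX : IsBNPC X} {P Q : X × X}
    (h : hX.ParallelPairs P Q) : ParallelSegments P.1 P.2 Q.1 Q.2 :=
  ⟨h.1, _, _, hX.isMidpoint_mid _ _, hX.isMidpoint_mid _ _, h.2⟩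

theorem IsBNPC.isClosed_parallelPairs (hX : IsBNPC X) :
    IsClosed {R : (X × X) × (X × X) | hX.ParallelPairs R.1 R.2} := by
  have hm := hX.continuous_mid
  refine (isClosed_eq ?_ ?_).inter (isClosed_eq ?_ ?_)
  · fun_prop
  · fun_prop
  · exact (hm.comp continuous_fst).dist (hm.comp continuous_snd)
  · fun_prop

/-- By strict convexity, two minimizers with the same energy span parallel segments at almost
every pair of points. -/
theorem ae_parallelPairs_of_energy_le [SFinite ν] (hX : IsBNPC X) (hk : IsInvariantKernel k)
    (hφ : StronglyMeasurable φ) (hψ : StronglyMeasurable ψ) (hfin : energy ν k F φ ≠ ∞)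
    (heq : energy ν k F ψ = energy ν k F φ)
    (hle : energy ν k F φ ≤ energy ν k F fun g => hX.mid (φ g) (ψ g)) :
    ∀ᵐ p ∂((ν.restrict F).prod ν),
      hX.ParallelPairs (φ p.2, ψ p.2) (φ p.1, ψ p.1) := by
  have hm : StronglyMeasurable fun g => hX.mid (φ g) (ψ g) :=
    hX.continuous_mid.comp_stronglyMeasurable (hφ.prodMk hψ)
  have hdist : ∀ {f : G → X}, StronglyMeasurable f →
      Measurable fun p : G × G => dist (f p.1) (f p.2) := fun hf =>
    ((hf.comp_measurable measurable_fst).dist (hf.comp_measurable measurable_snd)).measurable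
  have hmid_ne : energy ν k F (fun g => hX.mid (φ g) (ψ g)) ≠ ∞ :=
    ne_top_of_le_ne_top hfin (energy_mid_le hX hk hφ hψ le_rfl heq.le)
  have hsum := energy_mid_add (ν := ν) (F := F) hX hk hφ hψ
  rw [heq, ← two_mul, ← mul_assoc, ENNReal.inv_mul_cancel two_ne_zero ENNReal.ofNat_ne_top,
    one_mul] at hsum
  have hzero := (ENNReal.add_le_add_iff_left hmid_ne).1 ((hsum.le.trans hle).trans (add_zero _).ge)
  rw [nonpos_iff_eq_zero, lintegral_eq_zero_iff] at hzero
  · filter_upwards [hzero] with p hp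
    have hp' := (mul_eq_zero.1 hp).resolve_left (hk.ne_zero _ _)
    obtain ⟨h1, h2⟩ := eq_and_eq_of_sqDefect_nonpos dist_nonneg dist_nonneg
      (hX.dist_mid_mid_le _ _ _ _) (ENNReal.ofReal_eq_zero.1 hp')
    refine ⟨?_, ?_⟩
    · simpa only [dist_comm] using h1
    · simpa only [dist_comm] using h2
  · refine hk.measurable.mul (ENNReal.measurable_ofReal.comp ?_)
    exact ((((hdist hφ).pow_const 2).add ((hdist hψ).pow_const 2)).div_const 2).sub
      ((hdist hm).pow_const 2)

variable [MeasurableMul G]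

/-- If almost every pair of segments `[φ(g), ψ(g)]` is parallel then, parallelism being a closed
relation, so are `[x, y]` and `[γ x, γ y]` for `(x, y)` in the essential range of `(φ, ψ)`. The
absence of parallel orbits forces `x = y`. -/
theorem ae_eq_of_ae_parallelPairs [ν.IsMulLeftInvariant] [SFinite ν] [Countable N]
    (hX : IsBNPC X) (hpar : HasNoParallelOrbits α N) (hF : IsStrictFundamentalDomain ι N F)
    (hφ : IsAEEquivariant ι α ν N φ) (hψ : IsAEEquivariant ι α ν N ψ)
    (h : ∀ᵐ p ∂((ν.restrict F).prod ν), hX.ParallelPairs (φ p.2, ψ p.2) (φ p.1, ψ p.1)) :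
    φ =ᵐ[ν] ψ := by
  refine hF.ae_of_ae_restrict ?_ fun n hn => ?_
  · filter_upwards [(hφ.1.prodMk hψ.1).ae_measure_preimage_ne_zero (ν.restrict F)] with g hg
    by_contra hne
    obtain ⟨n, hn, hnpar⟩ := hpar _ _ hne
    set e := α n
    have hnot : ((e (φ g), e (ψ g)), (φ g, ψ g)) ∈
        {R : (X × X) × (X × X) | hX.ParallelPairs R.1 R.2}ᶜ :=
      fun hR => hnpar (IsBNPC.ParallelPairs.parallelSegments hR)
    have hnhds := hX.isClosed_parallelPairs.isOpen_compl.mem_nhds hnot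
    rw [nhds_prod_eq] at hnhds
    obtain ⟨V, hV, U, hU, hVU⟩ := mem_prod_iff.1 hnhds
    have hU0 := hg U hU
    have hcont : Continuous fun Q : X × X => (e Q.1, e Q.2) :=
      (e.continuous.comp continuous_fst).prodMk (e.continuous.comp continuous_snd)
    have hW0 := hg _ (hcont.continuousAt.preimage_mem_nhds hV)
    have hV0 : ν ((fun g => (φ g, ψ g)) ⁻¹' V) ≠ 0 := by
      intro h0
      refine hW0 (Measure.restrict_le_self.absolutelyContinuous ?_)
      rw [← measure_preimage_mul ν (ι n)] at h0
      refine (measure_congr ?_).trans h0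
      filter_upwards [hφ.2 n hn, hψ.2 n hn] with x h1 h2
      refine propext ?_
      change (e (φ x), e (ψ x)) ∈ V ↔ (φ (ι n * x), ψ (ι n * x)) ∈ V
      rw [h1, h2]
    have hnull : ((ν.restrict F).prod ν)
        (((fun g => (φ g, ψ g)) ⁻¹' U) ×ˢ ((fun g => (φ g, ψ g)) ⁻¹' V)) = 0 :=
      measure_mono_null (fun p hp => @hVU ((φ p.2, ψ p.2), (φ p.1, ψ p.1)) ⟨hp.2, hp.1⟩) h
    rw [Measure.prod_prod, mul_eq_zero] at hnull
    exact hnull.elim hU0 hV0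
  · filter_upwards [hφ.2 n hn, hψ.2 n hn] with g h1 h2 h3
    rw [h1, h2] at h3
    exact (α n).injective h3

theorem IsEnergyMinimizer.ae_eq [ν.IsMulLeftInvariant] [SFinite ν] [Countable N]
    (hX : IsBNPC X) (hk : IsInvariantKernel k) (hpar : HasNoParallelOrbits α N)
    (hF : IsStrictFundamentalDomain ι N F) (hφ : IsEnergyMinimizer ι α ν k N φ)
    (hψ : IsEnergyMinimizer ι α ν k N ψ) : φ =ᵐ[ν] ψ :=
  ae_eq_of_ae_parallelPairs hX hpar hF hφ.toIsAEEquivariant hψ.toIsAEEquivariant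
    (ae_parallelPairs_of_energy_le hX hk hφ.stronglyMeasurable hψ.stronglyMeasurable
      (hφ.energy_ne_top F hF)
      (le_antisymm (hψ.energy_le F hF φ hφ.toIsAEEquivariant)
        (hφ.energy_le F hF ψ hψ.toIsAEEquivariant))
      (hφ.energy_le F hF _ (hφ.toIsAEEquivariant.mid hX hψ.toIsAEEquivariant)))

theorem IsAEEquivariant.translate [ν.IsMulLeftInvariant] {a : H}
    (hφ : IsAEEquivariant ι α ν N φ) (h : ∀ n ∈ N', a⁻¹ * n * a ∈ N) :
    IsAEEquivariant ι α ν N' (leftTranslate ι α a φ) := by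
  refine ⟨(α a).continuous.comp_stronglyMeasurable
    (hφ.1.comp_measurable (measurable_const_mul _)), fun n hn => ?_⟩
  filter_upwards [ae_comp_mul_left (ι a⁻¹) (hφ.2 _ (h n hn))] with g hg
  have e1 : ι a⁻¹ * (ι n * g) = ι (a⁻¹ * n * a) * (ι a⁻¹ * g) := by
    simp only [map_mul, map_inv, mul_assoc, mul_inv_cancel_left]
  simp only [leftTranslate]
  rw [e1, hg]
  simp only [← IsometryEquiv.mul_apply, ← map_mul, mul_assoc, mul_inv_cancel_left]

theorem IsStrictFundamentalDomain.preimage_mul {a : H} (hF : IsStrictFundamentalDomain ι N' F)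
    (h : ∀ n, a⁻¹ * n * a ∈ N ↔ n ∈ N') :
    IsStrictFundamentalDomain ι N ((fun g => ι a * g) ⁻¹' F) := by
  refine ⟨hF.measurableSet.preimage (measurable_const_mul _), fun g => ?_⟩
  obtain ⟨n, ⟨hn, hnF⟩, huniq⟩ := hF.existsUnique (ι a * g)
  refine ⟨a⁻¹ * n * a, ⟨(h n).2 hn, ?_⟩, fun m hm => ?_⟩
  · simpa [mul_assoc] using hnF
  · have e : a⁻¹ * (a * m * a⁻¹) * a = m := by group
    have := huniq (a * m * a⁻¹) ⟨(h _).1 (by rw [e]; exact hm.1), by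
      simpa [mul_assoc] using hm.2⟩
    rw [← this, e]

theorem energy_leftTranslate [ν.IsMulLeftInvariant] (hk : IsInvariantKernel k) (a : H)
    (hF : MeasurableSet F) (φ : G → X) :
    energy ν k F (leftTranslate ι α a φ) = energy ν k ((fun g => ι a * g) ⁻¹' F) φ := by
  have hdens : ∀ g, ∫⁻ h, energyDensity k (leftTranslate ι α a φ) (g, h) ∂ν =
      ∫⁻ h, energyDensity k φ (ι a⁻¹ * g, h) ∂ν := fun g => by
    refine Eq.trans (lintegral_congr fun h => ?_)
      (lintegral_mul_left_eq_self (fun h => energyDensity k φ (ι a⁻¹ * g, h)) (ι a⁻¹))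
    simp only [energyDensity, hk.map_mul_mul, leftTranslate, IsometryEquiv.dist_eq]
  unfold energy
  rw [← lintegral_indicator hF, ← lintegral_indicator (hF.preimage (measurable_const_mul _)),
    ← lintegral_mul_left_eq_self _ (ι a)]
  refine lintegral_congr fun g => ?_
  by_cases hg : ι a * g ∈ F
  · rw [indicator_of_mem hg, indicator_of_mem (show g ∈ (fun g => ι a * g) ⁻¹' F from hg), hdens,
      ← mul_assoc, ← map_mul, inv_mul_cancel, map_one, one_mul]
  · rw [indicator_of_notMem hg,
      indicator_of_notMem (show g ∉ (fun g => ι a * g) ⁻¹' F from hg)]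

theorem IsEnergyMinimizer.translate [ν.IsMulLeftInvariant] (hk : IsInvariantKernel k) {a : H}
    (hφ : IsEnergyMinimizer ι α ν k N φ) (h : ∀ n, a⁻¹ * n * a ∈ N ↔ n ∈ N') :
    IsEnergyMinimizer ι α ν k N' (leftTranslate ι α a φ) := by
  refine ⟨hφ.toIsAEEquivariant.translate fun n hn => (h n).2 hn, fun F hF => ?_,
    fun F hF ψ hψ => ?_⟩
  · rw [energy_leftTranslate hk a hF.measurableSet]
    exact hφ.energy_ne_top _ (hF.preimage_mul h)
  · rw [← leftTranslate_leftTranslate_inv (ι := ι) (α := α) a ψ, energy_leftTranslate hk a hF.measurableSet,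
      energy_leftTranslate hk a hF.measurableSet]
    refine hφ.energy_le _ (hF.preimage_mul h) _ (hψ.translate fun n hn => ?_)
    rw [← h]
    simpa [mul_assoc] using hn

/-! ### Minimizers for commensurable subgroups coincide -/

/-- A subgroup of `Γ` of finite index contains one which is moreover normalized by `Γ`. -/
theorem Subgroup.exists_le_normalized_of_relIndex_ne_zero
    (hi : Γ₀.relIndex Γ ≠ 0) :
    ∃ N ≤ Γ₀, N.relIndex Γ ≠ 0 ∧ ∀ γ ∈ Γ, ∀ n, γ⁻¹ * n * γ ∈ N ↔ n ∈ N := by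
  have hfi : (Γ₀.subgroupOf Γ).FiniteIndex := ⟨hi⟩
  set M := (Γ₀.subgroupOf Γ).normalCore with hM
  have hMfi : M.FiniteIndex := inferInstance
  refine ⟨M.map Γ.subtype, ?_, ?_, ?_⟩
  · refine (Subgroup.map_mono (Subgroup.normalCore_le _)).trans ?_
    rw [Subgroup.subgroupOf_map_subtype]
    exact inf_le_left
  · rw [Subgroup.relIndex, Subgroup.subgroupOf,
      Subgroup.comap_map_eq_self_of_injective Γ.subtype_injective]
    exact hMfi.index_ne_zero
  · have key : ∀ γ ∈ Γ, ∀ n ∈ M.map Γ.subtype, γ⁻¹ * n * γ ∈ M.map Γ.subtype := by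
      rintro γ hγ _ ⟨n, hn, rfl⟩
      refine ⟨(⟨γ, hγ⟩ : Γ)⁻¹ * n * ⟨γ, hγ⟩, ?_, by simp⟩
      simpa using Subgroup.Normal.conj_mem (H := M) inferInstance n hn (⟨γ, hγ⟩ : Γ)⁻¹
    refine fun γ hγ n => ⟨fun h => ?_, key γ hγ n⟩
    have := key γ⁻¹ (Γ.inv_mem hγ) _ h
    simpa [mul_assoc] using this

end Uniqueness

section Commensurable

open MeasureTheory
open scoped ENNReal

variable {G H X : Type*} [Group G] [TopologicalSpace G] [IsTopologicalGroup G]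
  [LocallyCompactSpace G] [SigmaCompactSpace G] [MeasurableSpace G] [BorelSpace G] [Group H]
  [MetricSpace X] {ι : H →* G} {α : H →* (X ≃ᵢ X)} {ν : Measure G} {k : G → G → ℝ≥0∞}
  {Γ Γ₀ : Subgroup H} {φ : G → X}

/-- An energy minimizer for `Γ` is one for every subgroup of finite index: by uniqueness, the
minimizer for a subgroup normalized by `Γ` is itself `Γ`-equivariant. -/
theorem IsEnergyMinimizer.of_relIndex_ne_zero [ν.IsMulLeftInvariant] [SFinite ν]
    (hX : IsBNPC X) (hk : IsInvariantKernel k) (hΓ : IsDiscreteCocompact ι Γ)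
    (hex : ∀ N ≤ Γ, N.relIndex Γ ≠ 0 → ∃ ψ, IsEnergyMinimizer ι α ν k N ψ)
    (hpar : ∀ N ≤ Γ, N.relIndex Γ ≠ 0 → HasNoParallelOrbits α N)
    (hφ : IsEnergyMinimizer ι α ν k Γ φ) (hle : Γ₀ ≤ Γ) (hi : Γ₀.relIndex Γ ≠ 0) :
    IsEnergyMinimizer ι α ν k Γ₀ φ := by
  obtain ⟨N, hNΓ₀, hNi, hnorm⟩ := Subgroup.exists_le_normalized_of_relIndex_ne_zero hi
  have hNΓ := hNΓ₀.trans hle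
  have hNi₀ : N.relIndex Γ₀ ≠ 0 := fun h => hNi (by
    rw [← Subgroup.relIndex_mul_relIndex N Γ₀ Γ hNΓ₀ hle, h, zero_mul])
  have hΓ₀ := hΓ.of_finite_relIndex hle hi
  have hN := hΓ.of_finite_relIndex hNΓ hNi
  have := hΓ.countable
  have := hΓ₀.countable
  have := hN.countable
  obtain ⟨F, -, hF, -⟩ := hΓ.exists_fundamentalDomain
  obtain ⟨F₀, -, hF₀, -⟩ := hΓ₀.exists_fundamentalDomain
  obtain ⟨F', -, hF', -⟩ := hN.exists_fundamentalDomain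
  obtain ⟨ψ, hψ⟩ := hex N hNΓ hNi
  -- The translates of `ψ` by elements of `Γ` are again minimizers for the normalized `N`.
  have hψΓ : IsAEEquivariant ι α ν Γ ψ := by
    refine ⟨hψ.stronglyMeasurable, fun γ hγ => ?_⟩
    have h := (hψ.translate hk (hnorm γ hγ)).ae_eq hX hk (hpar N hNΓ hNi) hF' hψ
    filter_upwards [ae_comp_mul_left (ι γ) h] with g hg
    rw [← hg, leftTranslate, ← mul_assoc, ← map_mul, inv_mul_cancel, map_one, one_mul]
  have hφ' := hφ.toIsAEEquivariant
  have hφψ : energy ν k F' φ ≤ energy ν k F' ψ := by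
    rw [hφ'.energy_eq_relIndex_mul hk hF' hF hNΓ hNi, hψΓ.energy_eq_relIndex_mul hk hF' hF hNΓ hNi]
    gcongr
    exact hφ.energy_le F hF ψ hψΓ
  have hmul : ∀ χ, IsAEEquivariant ι α ν Γ₀ χ →
      energy ν k F' χ = N.relIndex Γ₀ * energy ν k F₀ χ := fun χ hχ =>
    hχ.energy_eq_relIndex_mul hk hF' hF₀ hNΓ₀ hNi₀
  have hne : (N.relIndex Γ₀ : ℝ≥0∞) ≠ 0 := Nat.cast_ne_zero.2 hNi₀
  refine (hφ'.mono hle).isEnergyMinimizer hk hF₀ (fun htop => ?_) fun χ hχ => ?_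
  · have h := hmul φ (hφ'.mono hle)
    rw [htop, ENNReal.mul_top hne] at h
    exact ne_top_of_le_ne_top (hψ.energy_ne_top F' hF') hφψ h
  · have h := hφψ.trans (hψ.energy_le F' hF' χ (hχ.mono hNΓ₀))
    rw [hmul φ (hφ'.mono hle), hmul χ hχ] at h
    exact (ENNReal.mul_le_mul_iff_right hne (ENNReal.natCast_ne_top _)).1 h

/-- The energy minimizer for `Γ` is equivariant under every element commensurating `Γ`: `φ` and
its translate both minimize the energy for `Γ ∩ a Γ a⁻¹`. -/
theorem IsEnergyMinimizer.ae_map_mul_of_commensurates [ν.IsMulLeftInvariant] [SFinite ν]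
    (hX : IsBNPC X) (hk : IsInvariantKernel k) (hΓ : IsDiscreteCocompact ι Γ)
    (hex : ∀ N ≤ Γ, N.relIndex Γ ≠ 0 → ∃ ψ, IsEnergyMinimizer ι α ν k N ψ)
    (hpar : ∀ N ≤ Γ, N.relIndex Γ ≠ 0 → HasNoParallelOrbits α N)
    (hφ : IsEnergyMinimizer ι α ν k Γ φ) {a : H}
    (ha : (Γ.map (MulAut.conj a).toMonoidHom).relIndex Γ ≠ 0)
    (ha' : (Γ.map (MulAut.conj a⁻¹).toMonoidHom).relIndex Γ ≠ 0) :
    ∀ᵐ g ∂ν, φ (ι a * g) = α a (φ g) := by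
  have hmem : ∀ b n, n ∈ Γ.map (MulAut.conj b).toMonoidHom ↔ b⁻¹ * n * b ∈ Γ := by
    intro b n
    constructor
    · rintro ⟨m, hm, rfl⟩
      simpa [mul_assoc] using hm
    · exact fun h => ⟨_, h, by simp [mul_assoc]⟩
  set Γ₀ := Γ.map (MulAut.conj a).toMonoidHom ⊓ Γ
  set Γ₁ := Γ.map (MulAut.conj a⁻¹).toMonoidHom ⊓ Γ
  have hi₀ : Γ₀.relIndex Γ ≠ 0 := by rwa [Subgroup.inf_relIndex_right]
  have hi₁ : Γ₁.relIndex Γ ≠ 0 := by rwa [Subgroup.inf_relIndex_right]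
  have h₀ := hφ.of_relIndex_ne_zero hX hk hΓ hex hpar inf_le_right hi₀
  have h₁ := hφ.of_relIndex_ne_zero hX hk hΓ hex hpar inf_le_right hi₁
  have hconj : ∀ n, a⁻¹ * n * a ∈ Γ₁ ↔ n ∈ Γ₀ := by
    intro n
    rw [Subgroup.mem_inf, Subgroup.mem_inf, hmem, hmem, and_comm]
    have : a⁻¹⁻¹ * (a⁻¹ * n * a) * a⁻¹ = n := by group
    rw [this]
  have hΓ₀ := hΓ.of_finite_relIndex inf_le_right hi₀
  have := hΓ₀.countable
  obtain ⟨F₀, -, hF₀, -⟩ := hΓ₀.exists_fundamentalDomain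
  have h := (h₁.translate hk hconj).ae_eq hX hk (hpar _ inf_le_right hi₀) hF₀ h₀
  filter_upwards [ae_comp_mul_left (ι a) h] with g hg
  rw [← hg, leftTranslate, ← mul_assoc, ← map_mul, inv_mul_cancel, map_one, one_mul]

end Commensurable

/-! ### Coercivity of the energy -/

section Coercivity

open MeasureTheory
open scoped ENNReal

variable {G H X : Type*} [Group G] [MeasurableSpace G] [Group H] [MetricSpace X]
  {ι : H →* G} {α : H →* (X ≃ᵢ X)} {ν : Measure G} {k : G → G → ℝ≥0∞}
  {N : Subgroup H} {F : Set G} {φ : G → X}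

theorem ofReal_sq_le_two_mul {a b c : ℝ} (ha : 0 ≤ a) (h : a ≤ b + c) :
    ENNReal.ofReal (a ^ 2) ≤ 2 * (ENNReal.ofReal (b ^ 2) + ENNReal.ofReal (c ^ 2)) := by
  rw [← ENNReal.ofReal_add (by positivity) (by positivity), ← ENNReal.ofReal_ofNat 2,
    ← ENNReal.ofReal_mul (by norm_num)]
  apply ENNReal.ofReal_le_ofReal
  nlinarith [mul_self_le_mul_self ha h, sq_nonneg (b - c)]

/-- The squared distance over `F` of `φ` from the constant map `x₀`. -/
noncomputable def sqDistFrom (ν : Measure G) (F : Set G) (x₀ : X) (φ : G → X) : ℝ≥0∞ :=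
  ∫⁻ g in F, ENNReal.ofReal (dist x₀ (φ g) ^ 2) ∂ν

theorem measurable_ofReal_dist_sq_prod {Ω : Type*} [MeasurableSpace Ω] {f₁ f₂ : Ω → X}
    (h₁ : StronglyMeasurable f₁) (h₂ : StronglyMeasurable f₂) :
    Measurable fun p : Ω × Ω => ENNReal.ofReal (dist (f₁ p.1) (f₂ p.2) ^ 2) :=
  ENNReal.measurable_ofReal.comp (Measurable.pow_const
    ((h₁.comp_measurable measurable_fst).dist (h₂.comp_measurable measurable_snd)).measurable 2)

variable [MeasurableMul G]

/-- The energy controls the mean squared distance between the values of `φ` on `F` and those of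
its translate by `s`. -/
theorem IsAEEquivariant.mul_lintegral_dist_le_energy [ν.IsMulLeftInvariant]
    (hφ : IsAEEquivariant ι α ν N φ) (hF : MeasurableSet F) {s : H} (hs : s ∈ N) {c : ℝ≥0∞}
    (hc : ∀ g ∈ F, ∀ h ∈ F, c ≤ k g (ι s * h)) :
    c * ∫⁻ g in F, ∫⁻ h in F, ENNReal.ofReal (dist (φ g) (α s (φ h)) ^ 2) ∂ν ∂ν ≤
      energy ν k F φ := by
  refine (lintegral_const_mul_le _ _).trans (setLIntegral_mono' hF fun g hg => ?_)
  calc c * ∫⁻ h in F, ENNReal.ofReal (dist (φ g) (α s (φ h)) ^ 2) ∂ν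
      ≤ ∫⁻ h in F, c * ENNReal.ofReal (dist (φ g) (α s (φ h)) ^ 2) ∂ν :=
        lintegral_const_mul_le _ _
    _ = ∫⁻ h in F, c * ENNReal.ofReal (dist (φ g) (φ (ι s * h)) ^ 2) ∂ν := by
        refine lintegral_congr_ae (ae_restrict_of_ae ?_)
        filter_upwards [hφ.2 s hs] with h hh
        rw [hh]
    _ ≤ ∫⁻ h in F, energyDensity k φ (g, ι s * h) ∂ν :=
        setLIntegral_mono' hF fun h hh => mul_le_mul_left (hc g hg h hh) _
    _ ≤ ∫⁻ h, energyDensity k φ (g, ι s * h) ∂ν := setLIntegral_le_lintegral _ _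
    _ = ∫⁻ h, energyDensity k φ (g, h) ∂ν :=
        lintegral_mul_left_eq_self (fun h => energyDensity k φ (g, h)) (ι s)

/-- Maps of bounded energy stay at bounded mean distance from a point. By averaging there is
`g₀ ∈ F` whose value `φ(g₀)` is moved a bounded amount by the generators and lies at bounded mean
distance from the values of `φ` on `F`; the properness of the displacement bounds `φ(g₀)`. -/
theorem exists_sqDistFrom_le_of_energy_le [ν.IsMulLeftInvariant] [SFinite ν]
    (hF : MeasurableSet F) (hF0 : ν F ≠ 0) (hFtop : ν F ≠ ∞)
    (hk : ∀ s ∈ N, ∃ c, c ≠ 0 ∧ c ≠ ∞ ∧ ∀ g ∈ F, ∀ h ∈ F, c ≤ k g (ι s * h))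
    {S : Finset H} (hS : ∀ s ∈ S, s ∈ N) (hdisp : DisplacementTendsToInfinity α S) (x₀ : X)
    {A : ℝ≥0∞} (hA : A ≠ ∞) :
    ∃ B, B ≠ ∞ ∧ ∀ φ, IsAEEquivariant ι α ν N φ → energy ν k F φ ≤ A →
      sqDistFrom ν F x₀ φ ≤ B := by
  classical
  have hk' : ∀ s : H, ∃ c, c ≠ 0 ∧ c ≠ ∞ ∧ (s ∈ N → ∀ g ∈ F, ∀ h ∈ F, c ≤ k g (ι s * h)) := by
    intro s
    by_cases hs : s ∈ N
    · obtain ⟨c, h1, h2, h3⟩ := hk s hs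
      exact ⟨c, h1, h2, fun _ => h3⟩
    · exact ⟨1, one_ne_zero, ENNReal.one_ne_top, fun h => absurd h hs⟩
  choose c hc0 hctop hc using hk'
  set T := insert 1 S with hT
  have hTN : ∀ s ∈ T, s ∈ N := fun s hs => by
    rcases Finset.mem_insert.1 hs with rfl | hs
    · exact N.one_mem
    · exact hS s hs
  -- `B₁` bounds the mean squared distances from `φ(g₀)`, and `M` the squared displacement there.
  set B₁ : ℝ≥0∞ := (∑ s ∈ T, (c s)⁻¹ * A) / ν F with hB₁
  have hB₁top : B₁ ≠ ∞ := ENNReal.div_ne_top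
    (ENNReal.sum_ne_top.2 fun s _ => ENNReal.mul_ne_top (ENNReal.inv_ne_top.2 (hc0 s)) hA) hF0
  set M : ℝ≥0∞ := 2 * (B₁ + B₁) / ν F with hM
  have hMtop : M ≠ ∞ := ENNReal.div_ne_top
    (ENNReal.mul_ne_top ENNReal.ofNat_ne_top (ENNReal.add_ne_top.2 ⟨hB₁top, hB₁top⟩)) hF0
  set ρ : ℝ := √M.toReal with hρ
  obtain ⟨R, hR⟩ : ∃ R, ∀ x, displacement α S x ≤ ρ → dist x x₀ ≤ R := by
    have h := hdisp.eventually_gt_atTop ρ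
    have hb : Bornology.IsBounded {x | displacement α S x ≤ ρ} := by
      rw [← Bornology.isCobounded_compl_iff]
      refine mem_of_superset h fun x hx => ?_
      exact not_le.2 (show ρ < displacement α S x from hx)
    obtain ⟨R, hR⟩ := hb.subset_closedBall x₀
    exact ⟨R, fun x hx => hR hx⟩
  refine ⟨2 * (ENNReal.ofReal (R ^ 2) * ν F + B₁), ENNReal.mul_ne_top ENNReal.ofNat_ne_top
    (ENNReal.add_ne_top.2 ⟨ENNReal.mul_ne_top ENNReal.ofReal_ne_top hFtop, hB₁top⟩),
    fun φ hφ hE => ?_⟩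
  set J : H → G → ℝ≥0∞ := fun s g =>
    ∫⁻ h in F, ENNReal.ofReal (dist (φ g) (α s (φ h)) ^ 2) ∂ν with hJ
  have hJm : ∀ s, Measurable (J s) := fun s =>
    (measurable_ofReal_dist_sq_prod hφ.1
      ((α s).continuous.comp_stronglyMeasurable hφ.1)).lintegral_prod_right'
  have hJle : ∀ s ∈ T, ∫⁻ g in F, J s g ∂ν ≤ (c s)⁻¹ * A := fun s hs => by
    rw [mul_comm, ← div_eq_mul_inv, ENNReal.le_div_iff_mul_le (Or.inl (hc0 s)) (Or.inl (hctop s)),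
      mul_comm]
    exact (hφ.mul_lintegral_dist_le_energy hF (hTN s hs) (hc s (hTN s hs))).trans hE
  obtain ⟨g₀, -, hg₀⟩ := exists_le_setLAverage hF0 hFtop
    (Finset.measurable_fun_sum T fun s _ => hJm s).aemeasurable
  have hJg₀ : ∀ s ∈ T, J s g₀ ≤ B₁ := fun s hs => by
    refine (Finset.single_le_sum (f := fun s => J s g₀) (fun _ _ => zero_le) hs).trans
      (hg₀.trans ?_)
    rw [setLAverage_eq, lintegral_finsetSum _ fun s _ => hJm s]
    exact ENNReal.div_le_div_right (Finset.sum_le_sum hJle) _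
  set y := φ g₀ with hy
  have hJ1 : ∫⁻ h in F, ENNReal.ofReal (dist y (φ h) ^ 2) ∂ν ≤ B₁ := by
    have := hJg₀ 1 (Finset.mem_insert_self _ _)
    simpa only [hJ, map_one, IsometryEquiv.coe_one, id_eq] using this
  have hmeas1 : Measurable fun h => ENNReal.ofReal (dist y (φ h) ^ 2) :=
    ENNReal.measurable_ofReal.comp
      ((stronglyMeasurable_const.dist hφ.1).measurable.pow_const 2)
  have hdispy : displacement α S y ≤ ρ := by
    have hs : ∀ s ∈ S, nndist (α s y) y ≤ ρ.toNNReal := fun s hs => by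
      rw [← NNReal.coe_le_coe, coe_nndist, Real.coe_toNNReal _ (Real.sqrt_nonneg _)]
      refine Real.le_sqrt_of_sq_le ((ENNReal.ofReal_le_iff_le_toReal hMtop).1 ?_)
      rw [hM, ENNReal.le_div_iff_mul_le (Or.inl hF0) (Or.inl hFtop)]
      calc ENNReal.ofReal (dist (α s y) y ^ 2) * ν F
          = ∫⁻ _ in F, ENNReal.ofReal (dist (α s y) y ^ 2) ∂ν := by rw [setLIntegral_const]
        _ ≤ ∫⁻ h in F, 2 * (ENNReal.ofReal (dist y (φ h) ^ 2) +
              ENNReal.ofReal (dist y (α s (φ h)) ^ 2)) ∂ν := by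
            refine lintegral_mono fun h => ofReal_sq_le_two_mul dist_nonneg ?_
            have := dist_triangle_right (α s y) y (α s (φ h))
            rwa [IsometryEquiv.dist_eq] at this
        _ = 2 * (∫⁻ h in F, ENNReal.ofReal (dist y (φ h) ^ 2) ∂ν + J s g₀) := by
            rw [lintegral_const_mul' _ _ ENNReal.ofNat_ne_top, lintegral_add_left hmeas1]
        _ ≤ 2 * (B₁ + B₁) := by
            gcongr
            exact hJg₀ s (Finset.mem_insert_of_mem hs)
    have := NNReal.coe_le_coe.2 (Finset.sup_le hs)
    rwa [Real.coe_toNNReal _ (Real.sqrt_nonneg _)] at this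
  have hRy := hR y hdispy
  calc sqDistFrom ν F x₀ φ
      ≤ ∫⁻ h in F, 2 * (ENNReal.ofReal (R ^ 2) + ENNReal.ofReal (dist y (φ h) ^ 2)) ∂ν := by
        refine lintegral_mono fun h => ofReal_sq_le_two_mul dist_nonneg ?_
        have := dist_triangle_left x₀ (φ h) y
        linarith
    _ = 2 * (ENNReal.ofReal (R ^ 2) * ν F + ∫⁻ h in F, ENNReal.ofReal (dist y (φ h) ^ 2) ∂ν) := by
        rw [lintegral_const_mul' _ _ ENNReal.ofNat_ne_top, lintegral_add_left measurable_const,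
          setLIntegral_const]
    _ ≤ 2 * (ENNReal.ofReal (R ^ 2) * ν F + B₁) := by gcongr

end Coercivity

/-! ### Existence of energy minimizers -/

section Existence

open MeasureTheory
open scoped ENNReal

/-- Let `E` be a functional whose sublevel sets are closed under taking midpoints and on which `D`
is bounded. Some `E`-minimizing sequence asymptotically minimizes `D` as well, in the sense that
passing to midpoints of its members does not decrease `D` any further. -/
theorem exists_minimizing_sequence {𝒞 : Type*} {E D : 𝒞 → ℝ≥0∞} {mid : 𝒞 → 𝒞 → 𝒞}
    (hmid : ∀ A u v, E u ≤ A → E v ≤ A → E (mid u v) ≤ A) (u₀ : 𝒞) (hu₀ : E u₀ ≠ ∞)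
    (hcoer : ∀ A, A ≠ ∞ → ∃ B, B ≠ ∞ ∧ ∀ u, E u ≤ A → D u ≤ B) :
    ∃ (u : ℕ → 𝒞) (r : ℝ≥0∞), r ≠ ∞ ∧ ∀ ε, ε ≠ 0 → ∃ n₀, ∀ n ≥ n₀, ∀ m ≥ n₀,
      E (u n) ≤ (⨅ v, E v) + ε ∧ D (u n) ≤ r + ε ∧ r ≤ D (mid (u n) (u m)) + ε := by
  set I := ⨅ v, E v with hI
  have hItop : I ≠ ∞ := ne_top_of_le_ne_top hu₀ (iInf_le _ _)
  let e : ℕ → ℝ≥0∞ := fun n => ((n : ℝ≥0∞) + 1)⁻¹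
  have he0 : ∀ n, e n ≠ 0 := fun n =>
    ENNReal.inv_ne_zero.2 (ENNReal.add_ne_top.2 ⟨ENNReal.natCast_ne_top n, ENNReal.one_ne_top⟩)
  have he1 : ∀ n, e n ≤ 1 := fun n => ENNReal.inv_le_one.2 le_add_self
  have hanti : Antitone e := fun n m h => ENNReal.inv_le_inv.2 (add_le_add_left (Nat.cast_le.2 h) 1)
  have hetend : Tendsto e atTop (𝓝 0) := by
    have := (tendsto_add_atTop_iff_nat 1).2 ENNReal.tendsto_inv_nat_nhds_zero
    simpa [e] using this
  let V : ℕ → Set 𝒞 := fun n => {v | E v ≤ I + e n}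
  have hVanti : Antitone V := fun n m h v hv => le_trans hv (add_le_add le_rfl (hanti h))
  have hVne : ∀ n, ∃ v, v ∈ V n := fun n => by
    obtain ⟨v, hv⟩ := iInf_lt_iff.1 (ENNReal.lt_add_right hItop (he0 n))
    exact ⟨v, hv.le⟩
  let r : ℕ → ℝ≥0∞ := fun n => ⨅ v ∈ V n, D v
  obtain ⟨B, hB, hBD⟩ := hcoer (I + 1) (ENNReal.add_ne_top.2 ⟨hItop, ENNReal.one_ne_top⟩)
  have hrB : ∀ n, r n ≤ B := fun n => by
    obtain ⟨v, hv⟩ := hVne n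
    exact (iInf₂_le v hv).trans (hBD v (le_trans hv (by gcongr; exact he1 n)))
  have hrtop : ∀ n, r n ≠ ∞ := fun n => ne_top_of_le_ne_top hB (hrB n)
  have hu : ∀ n, ∃ v, v ∈ V n ∧ D v ≤ r n + e n := fun n => by
    obtain ⟨v, hv⟩ := iInf_lt_iff.1 (ENNReal.lt_add_right (hrtop n) (he0 n))
    obtain ⟨hvV, hv⟩ := iInf_lt_iff.1 hv
    exact ⟨v, hvV, hv.le⟩
  choose u huV huD using hu
  have hRtop : (⨆ n, r n) ≠ ∞ := ne_top_of_le_ne_top hB (iSup_le hrB)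
  refine ⟨u, ⨆ n, r n, hRtop, fun ε hε => ?_⟩
  obtain ⟨n₁, hn₁⟩ : ∃ n₁, (⨆ n, r n) ≤ r n₁ + ε := by
    by_contra! h
    have : (⨆ n, r n) + ε ≤ ⨆ n, r n := by
      rw [ENNReal.iSup_add]
      exact iSup_le fun n => (h n).le
    exact absurd this (not_le.2 (ENNReal.lt_add_right hRtop hε))
  obtain ⟨n₂, hn₂⟩ := (hetend.eventually (Iic_mem_nhds (pos_iff_ne_zero.2 hε))).exists
  refine ⟨max n₁ n₂, fun n hn m hm => ⟨?_, ?_, ?_⟩⟩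
  · refine le_trans (huV n) ?_
    gcongr
    exact (hanti ((le_max_right _ _).trans hn)).trans hn₂
  · refine (huD n).trans ?_
    gcongr
    · exact le_iSup r n
    · exact (hanti ((le_max_right _ _).trans hn)).trans hn₂
  · refine hn₁.trans ?_
    gcongr
    refine iInf₂_le _ ?_
    exact hmid _ _ _ (hVanti ((le_max_left _ _).trans hn) (huV n))
      (hVanti ((le_max_left _ _).trans hm) (huV m))

/-- A sequence which is Cauchy in measure has an almost everywhere convergent subsequence. -/
theorem exists_subseq_ae_exists_tendsto {Ω X : Type*} [MeasurableSpace Ω] [MetricSpace X]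
    [CompleteSpace X] {μ : Measure Ω} {f : ℕ → Ω → X}
    (hf : ∀ ε : ℝ, 0 < ε → ∀ η : ℝ≥0∞, η ≠ 0 → η ≠ ∞ → ∃ n₀, ∀ n ≥ n₀, ∀ m ≥ n₀,
      μ {ω | ε ≤ dist (f n ω) (f m ω)} ≤ η) :
    ∃ ns : ℕ → ℕ, StrictMono ns ∧
      ∀ᵐ ω ∂μ, ∃ l, Tendsto (fun j => f (ns j) ω) atTop (𝓝 l) := by
  choose n₀ hn₀ using fun j : ℕ => hf ((1 / 2) ^ j) (by positivity) (2⁻¹ ^ j)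
    (pow_ne_zero _ (by simp)) (ENNReal.pow_ne_top (by simp))
  obtain ⟨ns, hns, hnsn₀⟩ := extraction_forall_of_eventually fun j => eventually_ge_atTop (n₀ j)
  refine ⟨ns, hns, ?_⟩
  have hsum : ∑' j, μ {ω | (1 / 2 : ℝ) ^ j ≤ dist (f (ns j) ω) (f (ns (j + 1)) ω)} ≠ ∞ := by
    refine ne_top_of_le_ne_top ?_ (ENNReal.tsum_le_tsum fun j => hn₀ j _ (hnsn₀ j) _
      ((hnsn₀ j).trans (hns j.lt_succ_self).le))
    rw [ENNReal.tsum_geometric]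
    simp
  filter_upwards [ae_eventually_notMem hsum] with ω hω
  refine cauchySeq_tendsto_of_complete (cauchySeq_of_summable_dist ?_)
  refine Summable.of_norm_bounded_eventually_nat summable_geometric_two ?_
  filter_upwards [hω] with j hj
  rw [Real.norm_of_nonneg dist_nonneg]
  exact (not_le.1 hj).le

variable {G X : Type*} [MeasurableSpace G] [MetricSpace X] {ν : Measure G} {F : Set G}
  {φ ψ : G → X}

theorem sqDistFrom_mid_add (hX : IsBNPC X) (x₀ : X) (hφ : StronglyMeasurable φ)
    (hψ : StronglyMeasurable ψ) :
    sqDistFrom ν F x₀ (fun g => hX.mid (φ g) (ψ g)) +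
      ∫⁻ g in F, ENNReal.ofReal (sqDefect (dist x₀ (φ g)) (dist x₀ (ψ g))
        (dist x₀ (hX.mid (φ g) (ψ g)))) ∂ν =
    2⁻¹ * (sqDistFrom ν F x₀ φ + sqDistFrom ν F x₀ ψ) := by
  have hmeas : ∀ {f : G → X}, StronglyMeasurable f →
      Measurable fun g => ENNReal.ofReal (dist x₀ (f g) ^ 2) := fun hf =>
    ENNReal.measurable_ofReal.comp ((stronglyMeasurable_const.dist hf).measurable.pow_const 2)
  have hm : StronglyMeasurable fun g => hX.mid (φ g) (ψ g) :=
    hX.continuous_mid.comp_stronglyMeasurable (hφ.prodMk hψ)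
  unfold sqDistFrom
  rw [← lintegral_add_left (hmeas hm), ← lintegral_add_left (hmeas hφ),
    ← lintegral_const_mul' _ _ (by simp)]
  exact lintegral_congr fun g =>
    ofReal_sq_add_ofReal_sqDefect dist_nonneg (hX.dist_mid_le _ _ _)

/-- By uniform convexity, a sequence of maps whose mean squared distance to `x₀` cannot be
decreased by passing to midpoints is Cauchy in measure. -/
theorem cauchy_in_measure_of_sqDistFrom (hX : IsBNPC X) (hUC : IsUniformlyConvexSpace X) (x₀ : X)
    {u : ℕ → G → X} (hu : ∀ n, StronglyMeasurable (u n)) {r : ℝ≥0∞} (hr : r ≠ ∞)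
    (h : ∀ ε : ℝ≥0∞, ε ≠ 0 → ∃ n₀, ∀ n ≥ n₀, ∀ m ≥ n₀, sqDistFrom ν F x₀ (u n) ≤ r + ε ∧
      r ≤ sqDistFrom ν F x₀ (fun g => hX.mid (u n g) (u m g)) + ε)
    {ε : ℝ} (hε : 0 < ε) {η : ℝ≥0∞} (hη : η ≠ 0) (hηtop : η ≠ ∞) :
    ∃ n₀, ∀ n ≥ n₀, ∀ m ≥ n₀, ν.restrict F {g | ε ≤ dist (u n g) (u m g)} ≤ η := by
  have hη3 : η / 3 ≠ 0 := (ENNReal.div_pos hη (by norm_num)).ne'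
  have hη3top : η / 3 ≠ ∞ := ENNReal.div_ne_top hηtop (by norm_num)
  -- Outside sets of measure at most `η / 3` the maps take values in the ball of radius `R`.
  obtain ⟨R, hR⟩ := ENNReal.exists_nat_mul_gt hη3
    (ENNReal.add_ne_top.2 ⟨hr, ENNReal.one_ne_top⟩ : r + 1 ≠ ∞)
  have hR0 : R ≠ 0 := by
    rintro rfl
    simp at hR
  have hR1 : (1 : ℝ) ≤ R := by exact_mod_cast Nat.one_le_iff_ne_zero.2 hR0
  obtain ⟨κ, hκ, hκle⟩ := hX.exists_le_sqDefect hUC hε (R := R) (by linarith)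
  have hκ0 : ENNReal.ofReal κ ≠ 0 := (ENNReal.ofReal_pos.2 hκ).ne'
  set δ : ℝ≥0∞ := min 1 (ENNReal.ofReal κ * (η / 3) / 2) with hδ
  have hδ0 : δ ≠ 0 := (lt_min one_pos
    (ENNReal.div_pos (mul_ne_zero hκ0 hη3) ENNReal.ofNat_ne_top)).ne'
  obtain ⟨n₀, hn₀⟩ := h δ hδ0
  have hdist_meas : ∀ n, Measurable fun g => dist x₀ (u n g) := fun n =>
    (stronglyMeasurable_const.dist (hu n)).measurable
  have hbig : ∀ n ≥ n₀, ν.restrict F {g | (R : ℝ) < dist x₀ (u n g)} ≤ η / 3 := by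
    intro n hn
    have h1 := mul_meas_ge_le_lintegral (μ := ν.restrict F)
      (ENNReal.measurable_ofReal.comp ((hdist_meas n).pow_const 2)) (R : ℝ≥0∞)
    have h2 : sqDistFrom ν F x₀ (u n) ≤ R * (η / 3) :=
      ((hn₀ n hn n hn).1.trans (by gcongr; exact min_le_left _ _)).trans hR.le
    have h3 := h1.trans h2
    rw [ENNReal.mul_le_mul_iff_right (Nat.cast_ne_zero.2 hR0) (ENNReal.natCast_ne_top R)] at h3
    refine le_trans (measure_mono fun g hg => ?_) h3
    have hg' : (R : ℝ) < dist x₀ (u n g) := hg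
    change (R : ℝ≥0∞) ≤ ENNReal.ofReal (dist x₀ (u n g) ^ 2)
    rw [← ENNReal.ofReal_natCast]
    exact ENNReal.ofReal_le_ofReal (by nlinarith)
  refine ⟨n₀, fun n hn m hm => ?_⟩
  have hdef : ν.restrict F {g | κ ≤ sqDefect (dist x₀ (u n g)) (dist x₀ (u m g))
      (dist x₀ (hX.mid (u n g) (u m g)))} ≤ η / 3 := by
    obtain ⟨hn1, hn2⟩ := hn₀ n hn m hm
    have hm1 := (hn₀ m hm n hn).1
    have hid := sqDistFrom_mid_add (ν := ν) (F := F) hX x₀ (hu n) (hu m)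
    set Dm := sqDistFrom ν F x₀ (fun g => hX.mid (u n g) (u m g)) with hDm
    set Ψ := ∫⁻ g in F, ENNReal.ofReal (sqDefect (dist x₀ (u n g)) (dist x₀ (u m g))
        (dist x₀ (hX.mid (u n g) (u m g)))) ∂ν with hΨ
    have hδtop : δ ≠ ∞ := ne_top_of_le_ne_top ENNReal.one_ne_top (min_le_left _ _)
    have hle : Dm + Ψ ≤ r + δ := by
      rw [hid]
      calc 2⁻¹ * (sqDistFrom ν F x₀ (u n) + sqDistFrom ν F x₀ (u m))
          ≤ 2⁻¹ * ((r + δ) + (r + δ)) := by gcongr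
        _ = r + δ := by
          rw [← two_mul, ← mul_assoc, ENNReal.inv_mul_cancel two_ne_zero ENNReal.ofNat_ne_top,
            one_mul]
    have hDmtop : Dm ≠ ∞ :=
      ne_top_of_le_ne_top (ENNReal.add_ne_top.2 ⟨hr, hδtop⟩) (le_self_add.trans hle)
    have hΨle : Ψ ≤ ENNReal.ofReal κ * (η / 3) := by
      have h1 : Dm + Ψ ≤ Dm + (δ + δ) :=
        hle.trans ((add_le_add_left hn2 δ).trans (add_assoc _ _ _).le)
      refine ((ENNReal.add_le_add_iff_left hDmtop).1 h1).trans ?_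
      calc δ + δ ≤ ENNReal.ofReal κ * (η / 3) / 2 + ENNReal.ofReal κ * (η / 3) / 2 := by
            gcongr <;> exact min_le_right _ _
        _ = _ := ENNReal.add_halves _
    have hmid : Measurable fun g => dist x₀ (hX.mid (u n g) (u m g)) :=
      (stronglyMeasurable_const.dist
        (hX.continuous_mid.comp_stronglyMeasurable ((hu n).prodMk (hu m)))).measurable
    have hmeas : Measurable fun g => ENNReal.ofReal (sqDefect (dist x₀ (u n g))
        (dist x₀ (u m g)) (dist x₀ (hX.mid (u n g) (u m g)))) :=
      ENNReal.measurable_ofReal.comp (((((hdist_meas n).pow_const 2).add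
        ((hdist_meas m).pow_const 2)).div_const 2).sub (hmid.pow_const 2))
    have h3 := (mul_meas_ge_le_lintegral (μ := ν.restrict F) hmeas
      (ENNReal.ofReal κ)).trans hΨle
    rw [ENNReal.mul_le_mul_iff_right hκ0 ENNReal.ofReal_ne_top] at h3
    exact le_trans (measure_mono fun g hg => ENNReal.ofReal_le_ofReal hg) h3
  calc ν.restrict F {g | ε ≤ dist (u n g) (u m g)}
      ≤ ν.restrict F (({g | (R : ℝ) < dist x₀ (u n g)} ∪ {g | (R : ℝ) < dist x₀ (u m g)}) ∪
          {g | κ ≤ sqDefect (dist x₀ (u n g)) (dist x₀ (u m g))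
            (dist x₀ (hX.mid (u n g) (u m g)))}) := by
        refine measure_mono fun g hg => ?_
        by_cases h1 : (R : ℝ) < dist x₀ (u n g)
        · exact Or.inl (Or.inl h1)
        by_cases h2 : (R : ℝ) < dist x₀ (u m g)
        · exact Or.inl (Or.inr h2)
        exact Or.inr (hκle x₀ _ _ (not_lt.1 h1) (not_lt.1 h2) hg)
    _ ≤ η / 3 + η / 3 + η / 3 := (measure_union_le _ _).trans
        (add_le_add ((measure_union_le _ _).trans (add_le_add (hbig n hn) (hbig m hm))) hdef)
    _ = η := ENNReal.add_thirds η

variable {H : Type*} [Group G] [Group H] {ι : H →* G} {α : H →* (X ≃ᵢ X)} {k : G → G → ℝ≥0∞}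
  {N : Subgroup H}

/-- Fatou's lemma for the energy. -/
theorem energy_le_of_ae_tendsto [SFinite ν] (hk : IsInvariantKernel k) {u : ℕ → G → X}
    (hu : ∀ n, StronglyMeasurable (u n)) (hφ : StronglyMeasurable φ)
    (hlim : ∀ᵐ g ∂ν, Tendsto (fun n => u n g) atTop (𝓝 (φ g))) {A : ℝ≥0∞}
    (hA : ∀ᶠ n in atTop, energy ν k F (u n) ≤ A) : energy ν k F φ ≤ A := by
  have h1 : ∀ᵐ p ∂((ν.restrict F).prod ν), Tendsto (fun n => u n p.1) atTop (𝓝 (φ p.1)) :=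
    Measure.quasiMeasurePreserving_fst.ae (ae_restrict_of_ae hlim)
  have h2 : ∀ᵐ p ∂((ν.restrict F).prod ν), Tendsto (fun n => u n p.2) atTop (𝓝 (φ p.2)) :=
    Measure.quasiMeasurePreserving_snd.ae hlim
  rw [energy_eq_lintegral_prod hk hφ]
  calc ∫⁻ p, energyDensity k φ p ∂((ν.restrict F).prod ν)
      = ∫⁻ p, liminf (fun n => energyDensity k (u n) p) atTop ∂((ν.restrict F).prod ν) := by
        refine lintegral_congr_ae ?_
        filter_upwards [h1, h2] with p hp1 hp2
        refine (Tendsto.liminf_eq ?_).symm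
        exact ENNReal.Tendsto.const_mul (ENNReal.tendsto_ofReal ((hp1.dist hp2).pow 2))
          (Or.inr (hk.ne_top _ _))
    _ ≤ liminf (fun n => ∫⁻ p, energyDensity k (u n) p ∂((ν.restrict F).prod ν)) atTop :=
        lintegral_liminf_le fun n => measurable_energyDensity hk (hu n)
    _ = liminf (fun n => energy ν k F (u n)) atTop := by
        simp_rw [energy_eq_lintegral_prod hk (hu _)]
    _ ≤ A := liminf_le_of_frequently_le' hA.frequently

variable [MeasurableMul G]

/-- Existence of minimizers: a minimizing sequence chosen by `exists_minimizing_sequence` is Cauchy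
in measure by uniform convexity, and converges almost everywhere along a subsequence. -/
theorem exists_isEnergyMinimizer [CompleteSpace X] [ν.IsMulLeftInvariant] [SFinite ν]
    [Countable N] (hX : IsBNPC X) (hUC : IsUniformlyConvexSpace X) (hk : IsInvariantKernel k)
    (hF : IsStrictFundamentalDomain ι N F) (hF0 : ν F ≠ 0) (hFtop : ν F ≠ ∞)
    (hklow : ∀ s ∈ N, ∃ c, c ≠ 0 ∧ c ≠ ∞ ∧ ∀ g ∈ F, ∀ h ∈ F, c ≤ k g (ι s * h))
    {S : Finset H} (hS : ∀ s ∈ S, s ∈ N) (hdisp : DisplacementTendsToInfinity α S)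
    {φ₀ : G → X} (hφ₀ : IsAEEquivariant ι α ν N φ₀) (hfin : energy ν k F φ₀ ≠ ∞) :
    ∃ φ, IsEnergyMinimizer ι α ν k N φ := by
  let x₀ := φ₀ 1
  obtain ⟨u, r, hr, hu⟩ := exists_minimizing_sequence
    (𝒞 := {φ : G → X // IsAEEquivariant ι α ν N φ}) (E := fun φ => energy ν k F φ.1)
    (D := fun φ => sqDistFrom ν F x₀ φ.1)
    (mid := fun φ ψ => ⟨fun g => hX.mid (φ.1 g) (ψ.1 g), φ.2.mid hX ψ.2⟩)
    (fun A u v h1 h2 => energy_mid_le hX hk u.2.1 v.2.1 h1 h2) ⟨φ₀, hφ₀⟩ hfin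
    (fun A hA => (exists_sqDistFrom_le_of_energy_le hF.1 hF0 hFtop hklow hS hdisp x₀ hA).imp
      fun B hB => ⟨hB.1, fun u => hB.2 u.1 u.2⟩)
  obtain ⟨ns, hns, hconv⟩ := exists_subseq_ae_exists_tendsto (μ := ν.restrict F)
    (f := fun n => (u n).1) fun ε hε η hη hηtop =>
      cauchy_in_measure_of_sqDistFrom hX hUC x₀ (fun n => (u n).2.1) hr
        (fun ε hε => (hu ε hε).imp fun n₀ h n hn m hm => (h n hn m hm).2) hε hη hηtop
  have hequiv : ∀ n ∈ N, ∀ᵐ g ∂ν, ∀ j, (u (ns j)).1 (ι n * g) = α n ((u (ns j)).1 g) :=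
    fun n hn => ae_all_iff.2 fun j => (u (ns j)).2.2 n hn
  have hconv' : ∀ᵐ g ∂ν, ∃ l, Tendsto (fun j => (u (ns j)).1 g) atTop (𝓝 l) := by
    refine hF.ae_of_ae_restrict hconv fun n hn => ?_
    filter_upwards [hequiv n hn] with g hg
    rintro ⟨l, hl⟩
    refine ⟨(α n).symm l, ?_⟩
    simp_rw [hg] at hl
    simpa [Function.comp_def] using ((α n).symm.continuous.tendsto l).comp hl
  obtain ⟨φ, hφ, hlim⟩ := exists_stronglyMeasurable_limit_of_tendsto_ae
    (fun j => (u (ns j)).2.1.aestronglyMeasurable) hconv'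
  have hφN : IsAEEquivariant ι α ν N φ := by
    refine ⟨hφ, fun n hn => ?_⟩
    filter_upwards [hequiv n hn, hlim, ae_comp_mul_left (ι n) hlim] with g h1 h2 h3
    simp_rw [h1] at h3
    exact tendsto_nhds_unique h3 (((α n).continuous.tendsto _).comp h2)
  have hle : energy ν k F φ ≤ ⨅ v : {φ : G → X // IsAEEquivariant ι α ν N φ},
      energy ν k F v.1 := by
    refine ENNReal.le_of_forall_pos_le_add fun ε hε _ => ?_
    obtain ⟨n₀, hn₀⟩ := hu ε (by exact_mod_cast hε.ne')
    refine energy_le_of_ae_tendsto hk (fun j => (u (ns j)).2.1) hφ hlim ?_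
    filter_upwards [eventually_ge_atTop n₀] with j hj
    have := hj.trans (hns.id_le j)
    exact (hn₀ _ this _ this).1
  have hle' : ∀ ψ, IsAEEquivariant ι α ν N ψ → energy ν k F φ ≤ energy ν k F ψ := fun ψ hψ =>
    hle.trans (iInf_le (fun v : {φ : G → X // IsAEEquivariant ι α ν N φ} => energy ν k F v.1)
      ⟨ψ, hψ⟩)
  exact ⟨φ, hφN.isEnergyMinimizer hk hF (ne_top_of_le_ne_top hfin (hle' φ₀ hφ₀)) hle'⟩

end Existence

/-! ### Equivariant maps of finite energy -/

section OrbitMap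

open MeasureTheory Pointwise

variable {G H X : Type*} [Group G] [TopologicalSpace G] [IsTopologicalGroup G]
  [SigmaCompactSpace G] [MeasurableSpace G] [BorelSpace G] [Group H] [MetricSpace X]
  {ι : H →* G} {N : Subgroup H} {F C : Set G}

/-- The equivariant map sending the whole fundamental domain to one point, together with bounds on
its displacement along compact sets. -/
theorem IsDiscreteCocompact.exists_isAEEquivariant (hN : IsDiscreteCocompact ι N)
    (hF : IsStrictFundamentalDomain ι N F) (hC : IsCompact C) (hFC : F ⊆ C) (x₀ : X)
    (α : H →* (X ≃ᵢ X)) (ν : Measure G) :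
    ∃ φ : G → X, IsAEEquivariant ι α ν N φ ∧ ∃ b : Set G → ℝ, ∀ g ∈ F, ∀ K, IsCompact K →
      ∀ a ∈ K, dist (φ g) (φ (g * a)) ≤ b K := by
  have := hN.countable
  choose p hp huniq using hF.existsUnique
  simp only [and_imp] at huniq
  let φ : G → X := fun g => α (p g)⁻¹ x₀
  have hφ : StronglyMeasurable φ := by
    let q : G → N := fun g => ⟨p g, (hp g).1⟩
    let _ : MeasurableSpace N := ⊤
    have hq : Measurable q := by
      refine measurable_to_countable' fun n => ?_
      have : q ⁻¹' {n} = (fun g => ι n * g) ⁻¹' F := by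
        ext g
        simp only [mem_preimage, mem_singleton_iff, q]
        constructor
        · rintro rfl
          exact (hp g).2
        · exact fun h => Subtype.ext (huniq g n n.2 h).symm
      rw [this]
      exact hF.1.preimage (measurable_const_mul _)
    exact (StronglyMeasurable.of_discrete (f := fun n : N => α (n : H)⁻¹ x₀)).comp_measurable hq
  have hpinv : ∀ n ∈ N, ∀ g, p (ι n * g) = p g * n⁻¹ := fun n hn g =>
    (huniq (ι n * g) (p g * n⁻¹) (N.mul_mem (hp g).1 (N.inv_mem hn))
      (by simpa [mul_assoc] using (hp g).2)).symm
  refine ⟨φ, ⟨hφ, fun n hn => .of_forall fun g => ?_⟩, ?_⟩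
  · simp only [φ]
    rw [hpinv n hn, mul_inv_rev, inv_inv, map_mul, IsometryEquiv.mul_apply]
  · have hb : ∀ K : Set G, ∃ r, IsCompact K → ∀ g ∈ F, ∀ a ∈ K,
        dist (φ g) (φ (g * a)) ≤ r := by
      intro K
      by_cases hK : IsCompact K
      · have hfin := hN.finite_inter (hC.mul (hC.mul hK).inv)
        obtain ⟨r, hr⟩ := (hfin.image fun n => dist x₀ (α n⁻¹ x₀)).bddAbove
        refine ⟨r, fun _ g hg a ha => hr ⟨p (g * a), ⟨(hp _).1, ?_⟩, ?_⟩⟩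
        · exact ⟨_, hFC (hp (g * a)).2, (g * a)⁻¹, inv_mem_inv.2 (mul_mem_mul (hFC hg) ha),
            mul_inv_cancel_right _ _⟩
        · have : p g = 1 := (huniq g 1 N.one_mem (by simpa using hg)).symm
          simp [φ, this]
      · exact ⟨0, fun h => absurd h hK⟩
    choose b hb using hb
    exact ⟨b, fun g hg K hK a ha => hb K hK g hg a ha⟩

end OrbitMap

section Kernel

open MeasureTheory Pointwise
open scoped ENNReal

variable {G H X : Type*} [Group G] [TopologicalSpace G] [IsTopologicalGroup G]
  [LocallyCompactSpace G] [SigmaCompactSpace G] [T2Space G] [MeasurableSpace G] [BorelSpace G]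
  [Group H] [MetricSpace X] {ι : H →* G} {α : H →* (X ≃ᵢ X)} {ν : Measure G}
  {Γ : Subgroup H}

/-- For `f` continuous with compact support, `(g, h) ↦ f (g⁻¹ h)` is measurable for the product of
the Borel σ-algebras, although the group need not be second countable. -/
theorem measurable_comp_inv_mul {f : C(G, ℝ)} (hf : HasCompactSupport f) :
    Measurable fun p : G × G => f (p.1⁻¹ * p.2) := by
  let K : CompactExhaustion G := default
  have hχ : ∀ j, ∃ χ : C(G, ℝ), EqOn χ 1 (K j) ∧ HasCompactSupport χ := fun j => by
    obtain ⟨χ, h1, -, h2, -⟩ := exists_continuous_one_zero_of_isCompact (K.isCompact j)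
      isClosed_empty (disjoint_empty _)
    exact ⟨χ, h1, h2⟩
  choose χ hχ1 hχs using hχ
  have hmeas : ∀ j, Measurable fun p : G × G => χ j p.1 * f (p.1⁻¹ * p.2) := fun j => by
    refine HasCompactSupport.measurable_of_prod (by fun_prop) ?_
    have hK := (hχs j).isCompact.prod ((hχs j).isCompact.mul hf.isCompact)
    refine HasCompactSupport.intro hK fun p hp => ?_
    by_contra hne
    obtain ⟨h1, h2⟩ := mul_ne_zero_iff.1 hne
    have h1' := subset_tsupport _ (Function.mem_support.2 h1)
    exact hp ⟨h1', p.1, h1', _, subset_tsupport _ (Function.mem_support.2 h2), by simp⟩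
  refine measurable_of_tendsto_metrizable hmeas (tendsto_pi_nhds.2 fun p => ?_)
  refine tendsto_const_nhds.congr' ?_
  obtain ⟨j₀, hj₀⟩ := mem_iUnion.1 (K.iUnion_eq ▸ mem_univ p.1)
  filter_upwards [eventually_ge_atTop j₀] with j hj
  rw [hχ1 j (K.subset hj hj₀), Pi.one_apply, one_mul]

/-- There is an invariant kernel decaying as fast as prescribed: a map whose displacement along each
compact set `K` is at most `b K` has bounded energy density. -/
theorem exists_isInvariantKernel [IsFiniteMeasureOnCompacts ν] [ν.IsMulLeftInvariant]
    (b : Set G → ℝ) :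
    ∃ k : G → G → ℝ≥0∞, IsInvariantKernel k ∧
      (∀ C, IsCompact C → ∃ c, c ≠ 0 ∧ c ≠ ∞ ∧ ∀ g ∈ C, ∀ h ∈ C, c ≤ k g h) ∧
      ∀ (φ : G → X) (g : G), StronglyMeasurable φ →
        (∀ K, IsCompact K → ∀ a ∈ K, dist (φ g) (φ (g * a)) ≤ b K) →
        ∫⁻ h, energyDensity k φ (g, h) ∂ν ≤ 2 := by
  let K : CompactExhaustion G := default
  have hf : ∀ j, ∃ f : C(G, ℝ), EqOn f 1 (K j) ∧ EqOn f 0 (interior (K (j + 1)))ᶜ ∧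
      HasCompactSupport f ∧ ∀ x, f x ∈ Icc (0 : ℝ) 1 := fun j =>
    exists_continuous_one_zero_of_isCompact (K.isCompact j) isOpen_interior.isClosed_compl
      (disjoint_compl_right_iff_subset.2 (K.subset_interior_succ j))
  choose f hf1 hf0 hfs hfI using hf
  let B : ℕ → ℝ≥0∞ := fun j => ENNReal.ofReal (b (K (j + 1)) ^ 2) * ν (K (j + 1))
  have hB : ∀ j, B j ≠ ∞ := fun j =>
    ENNReal.mul_ne_top ENNReal.ofReal_ne_top (K.isCompact _).measure_ne_top
  let c : ℕ → ℝ≥0∞ := fun j => 2⁻¹ ^ j * (1 + B j)⁻¹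
  have hc0 : ∀ j, c j ≠ 0 := fun j => mul_ne_zero (pow_ne_zero _ (by simp))
    (ENNReal.inv_ne_zero.2 (ENNReal.add_ne_top.2 ⟨ENNReal.one_ne_top, hB j⟩))
  have hcle : ∀ j, c j ≤ 2⁻¹ ^ j := fun j =>
    mul_le_of_le_one_right' (ENNReal.inv_le_one.2 le_self_add)
  have hcB : ∀ j, c j * B j ≤ 2⁻¹ ^ j := fun j => by
    rw [mul_assoc]
    refine mul_le_of_le_one_right' ?_
    rw [mul_comm, ← div_eq_mul_inv]
    exact ENNReal.div_le_of_le_mul (by rw [one_mul]; exact le_add_self)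
  have hsum : ∑' j : ℕ, (2⁻¹ : ℝ≥0∞) ^ j = 2 := by
    rw [ENNReal.tsum_geometric, ENNReal.one_sub_inv_two, inv_inv]
  have hctop : ∀ j, c j ≠ ∞ := fun j =>
    ne_top_of_le_ne_top (ENNReal.pow_ne_top (by simp)) (hcle j)
  have hlow : ∀ j g h, g⁻¹ * h ∈ K j → c j ≤ ∑' j, c j * ENNReal.ofReal (f j (g⁻¹ * h)) := by
    intro j g h hgh
    refine le_trans ?_ (ENNReal.le_tsum j)
    rw [hf1 j hgh, Pi.one_apply, ENNReal.ofReal_one, mul_one]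
  refine ⟨fun g h => ∑' j, c j * ENNReal.ofReal (f j (g⁻¹ * h)), ⟨?_, ?_, ?_, ?_⟩, ?_, ?_⟩
  · exact Measurable.tsum fun j => measurable_const.mul
      (ENNReal.measurable_ofReal.comp (measurable_comp_inv_mul (hfs j)))
  · intro g h
    obtain ⟨j, hj⟩ := mem_iUnion.1 (K.iUnion_eq ▸ mem_univ (g⁻¹ * h))
    exact fun h0 => hc0 j (nonpos_iff_eq_zero.1 (h0 ▸ hlow j g h hj))
  · intro g h
    refine ne_top_of_le_ne_top (ENNReal.ofNat_ne_top (n := 2)) ?_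
    rw [← hsum]
    refine ENNReal.tsum_le_tsum fun j => le_trans (mul_le_of_le_one_right' ?_) (hcle j)
    exact ENNReal.ofReal_le_one.2 (hfI j _).2
  · intro a g h
    simp only [mul_inv_rev, mul_assoc, inv_mul_cancel_left]
  · intro C hC
    obtain ⟨j, hj⟩ := K.exists_superset_of_isCompact (hC.inv.mul hC)
    exact ⟨c j, hc0 j, hctop j, fun g hg h hh =>
      hlow j g h (hj (mul_mem_mul (inv_mem_inv.2 hg) hh))⟩
  · intro φ g hφ hφb
    have hd : Measurable fun h => ENNReal.ofReal (dist (φ g) (φ h) ^ 2) :=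
      ENNReal.measurable_ofReal.comp ((stronglyMeasurable_const.dist hφ).measurable.pow_const 2)
    have hfm : ∀ j, Measurable fun h => c j * ENNReal.ofReal (f j (g⁻¹ * h)) := fun j =>
      measurable_const.mul (ENNReal.measurable_ofReal.comp
        ((f j).continuous.measurable.comp (measurable_const_mul g⁻¹)))
    calc ∫⁻ h, energyDensity (fun g h => ∑' j, c j * ENNReal.ofReal (f j (g⁻¹ * h))) φ (g, h) ∂ν
        = ∑' j, ∫⁻ h, c j * ENNReal.ofReal (f j (g⁻¹ * h)) *
            ENNReal.ofReal (dist (φ g) (φ h) ^ 2) ∂ν := by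
          refine Eq.trans (lintegral_congr fun h => ?_)
            (lintegral_tsum fun j => ((hfm j).mul hd).aemeasurable)
          exact ENNReal.tsum_mul_right.symm
      _ ≤ ∑' j : ℕ, (2⁻¹ : ℝ≥0∞) ^ j := by
          refine ENNReal.tsum_le_tsum fun j => le_trans ?_ (hcB j)
          calc ∫⁻ h, c j * ENNReal.ofReal (f j (g⁻¹ * h)) *
                ENNReal.ofReal (dist (φ g) (φ h) ^ 2) ∂ν
              ≤ ∫⁻ h, (K (j + 1)).indicator
                  (fun _ => c j * ENNReal.ofReal (b (K (j + 1)) ^ 2)) (g⁻¹ * h) ∂ν := by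
                refine lintegral_mono fun h => ?_
                by_cases hh : g⁻¹ * h ∈ K (j + 1)
                · rw [indicator_of_mem hh]
                  have h1 := hφb _ (K.isCompact (j + 1)) _ hh
                  rw [mul_inv_cancel_left] at h1
                  refine mul_le_mul' (mul_le_of_le_one_right'
                    (ENNReal.ofReal_le_one.2 (hfI j _).2)) (ENNReal.ofReal_le_ofReal ?_)
                  exact pow_le_pow_left₀ dist_nonneg h1 2
                · rw [indicator_of_notMem hh, hf0 j fun h' => hh (interior_subset h')]
                  simp
            _ = c j * B j := by
                rw [lintegral_mul_left_eq_self (μ := ν) ((K (j + 1)).indicator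
                  fun _ => c j * ENNReal.ofReal (b (K (j + 1)) ^ 2)) g⁻¹,
                  lintegral_indicator_const (K.isCompact _).measurableSet, mul_assoc]
      _ = 2 := hsum

/-- If every finite-index subgroup of `Γ` has proper displacement functions and no parallel orbits,
and every element of `H` commensurates `Γ`, then the energy minimizer for `Γ` is a measurable map to
`X` which is almost everywhere equivariant under each element of `H`. -/
theorem IsDiscreteCocompact.exists_commensurator_equivariant [CompleteSpace X] [Nonempty X]
    [ν.IsHaarMeasure] (hG : IsCompactlyGeneratedGroup G) (hX : IsBNPC X)
    (hUC : IsUniformlyConvexSpace X) (hΓ : IsDiscreteCocompact ι Γ)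
    (hdisp : ∀ N ≤ Γ, N.relIndex Γ ≠ 0 → ∀ S : Finset H, Subgroup.closure (S : Set H) = N →
      DisplacementTendsToInfinity α S)
    (hpar : ∀ N ≤ Γ, N.relIndex Γ ≠ 0 → HasNoParallelOrbits α N)
    (hcomm : ∀ a : H, (Γ.map (MulAut.conj a).toMonoidHom).relIndex Γ ≠ 0) :
    ∃ φ : G → X, StronglyMeasurable φ ∧ ∀ a, ∀ᵐ g ∂ν, φ (ι a * g) = α a (φ g) := by
  obtain ⟨x₀⟩ := ‹Nonempty X›
  have := hΓ.countable
  obtain ⟨F, C, hF, hC, hFC⟩ := hΓ.exists_fundamentalDomain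
  obtain ⟨φ₀, hφ₀, b, hb⟩ := hΓ.exists_isAEEquivariant hF hC hFC x₀ α ν
  obtain ⟨k, hk, hklow, hkle⟩ := exists_isInvariantKernel (X := X) (ν := ν) b
  have hfin : energy ν k F φ₀ ≠ ∞ := by
    refine ne_top_of_le_ne_top ?_
      (setLIntegral_mono' hF.1 fun g hg => hkle φ₀ g hφ₀.1 fun K hK a ha => hb g hg K hK a ha)
    rw [setLIntegral_const]
    exact ENNReal.mul_ne_top ENNReal.ofNat_ne_top (ne_top_of_le_ne_top hC.measure_ne_top (measure_mono hFC))
  have hex : ∀ N ≤ Γ, N.relIndex Γ ≠ 0 → ∃ ψ, IsEnergyMinimizer ι α ν k N ψ := by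
    intro N hNΓ hi
    have hN := hΓ.of_finite_relIndex hNΓ hi
    have := hN.countable
    obtain ⟨F', C', hF', hC', hFC'⟩ := hN.exists_fundamentalDomain
    obtain ⟨S, hS⟩ := hN.exists_closure_eq hG
    refine exists_isEnergyMinimizer hX hUC hk hF' hF'.measure_ne_zero
      (ne_top_of_le_ne_top hC'.measure_ne_top (measure_mono hFC')) (fun s _ => ?_)
      (fun s hs => hS ▸ Subgroup.subset_closure hs) (hdisp N hNΓ hi S hS) (hφ₀.mono hNΓ) ?_
    · obtain ⟨c, h1, h2, h3⟩ := hklow _ (hC'.union (hC'.image (continuous_const_mul (ι s))))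
      exact ⟨c, h1, h2, fun g hg h hh =>
        h3 g (Or.inl (hFC' hg)) _ (Or.inr ⟨h, hFC' hh, rfl⟩)⟩
    · rw [hφ₀.energy_eq_relIndex_mul hk hF' hF hNΓ hi]
      exact ENNReal.mul_ne_top (ENNReal.natCast_ne_top _) hfin
  obtain ⟨φ, hφ⟩ := hex Γ le_rfl (by simp)
  exact ⟨φ, hφ.stronglyMeasurable, fun a =>
    hφ.ae_map_mul_of_commensurates hX hk hΓ hex hpar (hcomm a) (hcomm a⁻¹)⟩

end Kernel

/-! ### Continuity of the orbit maps -/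

section Continuity

open MeasureTheory Pointwise
open scoped ENNReal

variable {G H X : Type*} [Group G] [TopologicalSpace G] [IsTopologicalGroup G] [Group H]
  [MetricSpace X] {ι : H →* G} {α : H →* (X ≃ᵢ X)}

/-- Points of the essential range of an equivariant map have continuous orbit maps: if `φ` is
`ε`-close to `x` on a compact set `K` of positive measure, then `a K` meets `K` in positive measure
for `a` near `1`, and there `a x`, `a φ(g) = φ(a g)` and `x` are close to each other. -/
theorem tendsto_orbit_of_measure_preimage_ne_zero [LocallyCompactSpace G] [SigmaCompactSpace G]
    [T2Space G] [MeasurableSpace G] [BorelSpace G] {ν : Measure G} [ν.IsHaarMeasure] [ν.Regular]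
    {φ : G → X} (hφ : StronglyMeasurable φ) (heq : ∀ a, ∀ᵐ g ∂ν, φ (ι a * g) = α a (φ g)) {x : X}
    (hx : ∀ U ∈ 𝓝 x, ν (φ ⁻¹' U) ≠ 0) :
    Tendsto (fun a => α a x) (comap ι (𝓝 1)) (𝓝 x) := by
  refine Metric.tendsto_nhds.2 fun ε hε => ?_
  have hA : MeasurableSet (φ ⁻¹' Metric.ball x (ε / 2)) := by
    borelize X
    exact hφ.measurable Metric.isOpen_ball.measurableSet
  obtain ⟨K, hKA, hK, hK0⟩ := hA.exists_lt_isCompact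
    (pos_iff_ne_zero.2 (hx _ (Metric.ball_mem_nhds x (half_pos hε))))
  have hev := (tendsto_measure_smul_sdiff_isCompact_isClosed (μ := ν) hK hK.isClosed).eventually
    (Iio_mem_nhds hK0)
  filter_upwards [tendsto_comap.eventually hev] with a ha
  have hinter : ν (ι a • K ∩ K) ≠ 0 := by
    intro h0
    have h1 := measure_inter_add_sdiff (μ := ν) (ι a • K) hK.isClosed.measurableSet
    rw [h0, zero_add, measure_smul] at h1
    exact absurd h1 (ne_of_lt ha)
  rw [← measure_preimage_mul ν (ι a)] at hinter
  obtain ⟨g, hgK, hg⟩ : ∃ g, g ∈ (fun g => ι a * g) ⁻¹' (ι a • K ∩ K) ∧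
      φ (ι a * g) = α a (φ g) := by
    by_contra! h
    exact hinter (measure_mono_null (fun g hg => h g hg) (heq a))
  have h1 : dist (φ g) x < ε / 2 := hKA (by
    obtain ⟨g', hg', he⟩ := hgK.1
    rwa [← mul_left_cancel (a := ι a) he])
  have h2 : dist (φ (ι a * g)) x < ε / 2 := hKA hgK.2
  have h3 := dist_triangle_left (α a x) x (φ (ι a * g))
  rw [hg, IsometryEquiv.dist_eq, ← hg] at h3
  linarith

/-- The points with continuous orbit maps form a closed convex invariant set, so if there is one
such point and the action is minimal, then all points are of this kind. -/
theorem IsCMinimal.tendsto_orbit (hX : IsBNPC X) (hmin : IsCMinimal α) {x₀ : X}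
    (hx₀ : Tendsto (fun a => α a x₀) (comap ι (𝓝 1)) (𝓝 x₀)) (x : X) :
    Tendsto (fun a => α a x) (comap ι (𝓝 1)) (𝓝 x) := by
  suffices h : {x | Tendsto (fun a => α a x) (comap ι (𝓝 1)) (𝓝 x)} = univ from
    eq_univ_iff_forall.1 h x
  refine hmin _ ⟨x₀, hx₀⟩ ?_ ?_ ?_
  · refine isClosed_iff_clusterPt.2 fun y hy => Metric.tendsto_nhds.2 fun ε hε => ?_
    obtain ⟨z, hzy, hz⟩ := Metric.mem_closure_iff.1 (mem_closure_iff_clusterPt.2 hy) (ε / 3)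
      (by positivity)
    have hz' : Tendsto (fun a => α a z) (comap ι (𝓝 1)) (𝓝 z) := hzy
    filter_upwards [Metric.tendsto_nhds.1 hz' (ε / 3) (by positivity)] with a ha
    have h1 := dist_triangle4 (α a y) (α a z) z y
    rw [IsometryEquiv.dist_eq, dist_comm z y] at h1
    linarith
  · intro c hc h0 h1 t ht
    have h0' : Tendsto (fun a => α a (c 0)) (comap ι (𝓝 1)) (𝓝 (c 0)) := h0
    have h1' : Tendsto (fun a => α a (c 1)) (comap ι (𝓝 1)) (𝓝 (c 1)) := h1
    refine Metric.tendsto_nhds.2 fun ε hε => ?_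
    filter_upwards [Metric.tendsto_nhds.1 h0' ε hε, Metric.tendsto_nhds.1 h1' ε hε] with a ha0 ha1
    exact ((hX.convexOn_dist _ c (hc.map (α a)) hc).le_max_of_mem_Icc (by simp) (by simp)
      ht).trans_lt (max_lt ha0 ha1)
  · intro b y hy
    have hconj : Tendsto (fun a => b⁻¹ * a * b) (comap ι (𝓝 1)) (comap ι (𝓝 1)) := by
      rw [tendsto_comap_iff]
      have h : Tendsto (fun g => (ι b)⁻¹ * g * ι b) (𝓝 1) (𝓝 1) := by
        have : Continuous fun g : G => (ι b)⁻¹ * g * ι b := by fun_prop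
        simpa using this.tendsto 1
      refine (h.comp tendsto_comap).congr fun a => ?_
      simp
    have hy' : Tendsto (fun a => α a y) (comap ι (𝓝 1)) (𝓝 y) := hy
    refine (((α b).continuous.tendsto _).comp (hy'.comp hconj)).congr fun a => ?_
    simp only [Function.comp_apply, ← IsometryEquiv.mul_apply, ← map_mul]
    congr 2
    group

end Continuity

/-! ### Extension of an isometric action from a dense subgroup -/

section Extension

variable {G X : Type*} [Group G] [TopologicalSpace G] [IsTopologicalGroup G] [MetricSpace X]
  {Λ : Subgroup G}

theorem exists_continuous_extension_orbit [CompleteSpace X] (hΛ : Dense (Λ : Set G))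
    {α : Λ →* (X ≃ᵢ X)} (hα : ∀ x, Tendsto (fun l => α l x) (comap Λ.subtype (𝓝 1)) (𝓝 x))
    (x : X) : ∃ f : G → X, Continuous f ∧ ∀ l : Λ, f l = α l x := by
  have hd : IsDenseInducing ((↑) : Λ → G) := hΛ.isDenseInducing_val
  have hcauchy : ∀ g : G, Cauchy (map (fun l : Λ => α l x) (comap (↑) (𝓝 g))) := by
    intro g
    have : (comap ((↑) : Λ → G) (𝓝 g)).NeBot := hd.comap_nhds_neBot g
    refine Metric.cauchy_iff.2 ⟨inferInstance, fun ε hε => ?_⟩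
    obtain ⟨U, hU, hUε⟩ := mem_comap.1 (Metric.tendsto_nhds.1 (hα x) ε hε)
    have hcont : Tendsto (fun p : G × G => p.1⁻¹ * p.2) (𝓝 g ×ˢ 𝓝 g) (𝓝 1) := by
      have : Continuous fun p : G × G => p.1⁻¹ * p.2 := by fun_prop
      simpa [nhds_prod_eq] using this.tendsto (g, g)
    obtain ⟨W, hW, hWU⟩ := mem_prod_same_iff.1 (hcont hU)
    refine ⟨_, image_mem_map (preimage_mem_comap hW), ?_⟩
    rintro _ ⟨l, hl, rfl⟩ _ ⟨l', hl', rfl⟩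
    have hmem : l⁻¹ * l' ∈ (Λ.subtype ⁻¹' U) := @hWU ((l : G), (l' : G)) ⟨hl, hl'⟩
    have h : dist (α (l⁻¹ * l') x) x < ε := hUε hmem
    rw [dist_comm, ← (α l).dist_eq, ← IsometryEquiv.mul_apply, ← map_mul,
      mul_inv_cancel_left] at h
    exact h
  have hcont : Continuous fun l : Λ => α l x := by
    rw [continuous_iff_continuousAt]
    intro l
    rw [ContinuousAt, nhds_induced]
    obtain ⟨y, hy⟩ := CompleteSpace.complete (hcauchy l)
    have hpure : pure l ≤ comap ((↑) : Λ → G) (𝓝 (l : G)) := by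
      rw [← nhds_induced]
      exact pure_le_nhds l
    have : α l x = y := tendsto_nhds_unique (tendsto_pure_nhds (fun l : Λ => α l x) l)
      ((map_mono hpure).trans hy)
    rw [this]
    exact hy
  refine ⟨hd.extend fun l => α l x, hd.continuous_extend fun g => ?_, fun l => hd.extend_eq hcont l⟩
  exact CompleteSpace.complete (hcauchy g)

/-- An isometric action of a dense subgroup whose orbit maps are continuous at the identity extends
to a continuous isometric action. -/
theorem exists_continuous_extension_action [CompleteSpace X] (hΛ : Dense (Λ : Set G))
    {α : Λ →* (X ≃ᵢ X)} (hα : ∀ x, Tendsto (fun l => α l x) (comap Λ.subtype (𝓝 1)) (𝓝 x)) :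
    ∃ ρ : G →* (X ≃ᵢ X), Continuous (fun p : G × X => ρ p.1 p.2) ∧
      ∀ (l : Λ) (x : X), ρ l x = α l x := by
  choose f hf hfα using fun x => exists_continuous_extension_orbit hΛ hα x
  have hdist : ∀ g x y, dist (f x g) (f y g) = dist x y := by
    intro g x y
    refine hΛ.induction (P := fun g => dist (f x g) (f y g) = dist x y) (fun l hl => ?_)
      (isClosed_eq ((hf x).dist (hf y)) continuous_const) g
    rw [hfα x ⟨l, hl⟩, hfα y ⟨l, hl⟩, IsometryEquiv.dist_eq]
  have hjoint : Continuous fun p : G × X => f p.2 p.1 := by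
    rw [continuous_iff_continuousAt]
    rintro ⟨g, x⟩
    refine Metric.tendsto_nhds.2 fun ε hε => ?_
    have h1 := Metric.tendsto_nhds.1 ((hf x).tendsto g) (ε / 2) (half_pos hε)
    rw [nhds_prod_eq]
    filter_upwards [h1.prod_mk (Metric.ball_mem_nhds x (half_pos hε))] with p hp
    have h2 := dist_triangle (f p.2 p.1) (f x p.1) (f x g)
    rw [hdist] at h2
    have h3 : dist p.2 x < ε / 2 := hp.2
    have h4 : dist (f x p.1) (f x g) < ε / 2 := hp.1
    change dist (f p.2 p.1) (f x g) < ε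
    linarith
  have hmulΛ : ∀ (l : Λ) (h : G) x, f x (l * h) = α l (f x h) := by
    intro l h x
    refine hΛ.induction (P := fun h => f x (l * h) = α l (f x h)) (fun m hm => ?_)
      (isClosed_eq ((hf x).comp (continuous_const_mul _)) ((α l).continuous.comp (hf x))) h
    rw [hfα x ⟨m, hm⟩, ← IsometryEquiv.mul_apply, ← map_mul]
    exact hfα x (l * ⟨m, hm⟩)
  have hmul : ∀ g h x, f x (g * h) = f (f x h) g := by
    intro g h x
    refine hΛ.induction (P := fun g => f x (g * h) = f (f x h) g) (fun l hl => ?_)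
      (isClosed_eq ((hf x).comp (continuous_mul_const _)) (hf _)) g
    rw [hmulΛ ⟨l, hl⟩, hfα _ ⟨l, hl⟩]
  have hone : ∀ x, f x 1 = x := fun x => by
    have := hfα x 1
    rwa [map_one] at this
  refine ⟨⟨⟨fun g => IsometryEquiv.mk' (fun x => f x g) (fun x => f x g⁻¹) (fun x => ?_)
    (Isometry.of_dist_eq fun x y => hdist g x y), ?_⟩, ?_⟩, hjoint, fun l x => hfα x l⟩
  · rw [← hmul, mul_inv_cancel, hone]
  · ext x
    exact hone x
  · intro g h
    ext x
    exact hmul g h x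

end Extension

/-! ### From the lattice to subgroups of the dense subgroup -/

section Subgroups

open Pointwise

variable {G : Type*} [Group G] {Γ Λ : Subgroup G}

theorem IsCocompactLattice.isDiscreteCocompact [TopologicalSpace G] [IsTopologicalGroup G]
    [LocallyCompactSpace G] (hΓ : IsCocompactLattice Γ) (hΓΛ : Γ ≤ Λ) :
    IsDiscreteCocompact Λ.subtype (Γ.subgroupOf Λ) := by
  have := hΓ.discrete
  have := hΓ.cocompact
  constructor
  · have h1 : {(1 : Γ)} ∈ 𝓝 (1 : Γ) := by simp
    rw [nhds_induced, mem_comap] at h1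
    obtain ⟨V, hV, hVΓ⟩ := h1
    refine ⟨V, hV, fun n hn hnV => ?_⟩
    have : (⟨n, hn⟩ : Γ) = 1 := @hVΓ ⟨n, hn⟩ hnV
    have h2 : (n : G) = 1 := congrArg (fun γ : Γ => (γ : G)) this
    exact Subtype.ext h2
  · obtain ⟨K, hK, hK1⟩ := exists_compact_mem_nhds (1 : G)
    obtain ⟨t, -, ht⟩ := (isCompact_univ (X := G ⧸ Γ)).elim_nhds_subcover
      (fun q => (fun g : G => (g : G ⧸ Γ)) '' ((fun g => q.out * g) '' K)) fun q _ => by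
        have h1 : (fun g => q.out * g) '' K ∈ 𝓝 q.out := by
          simpa using (isOpenMap_mul_left q.out).image_mem_nhds hK1
        have h2 := (QuotientGroup.isOpenMap_coe (N := Γ)).image_mem_nhds h1
        rwa [show ((q.out : G) : G ⧸ Γ) = q from Quotient.out_eq' q] at h2
    refine ⟨(⋃ q ∈ t, (fun g => q.out * g) '' K)⁻¹,
      (t.isCompact_biUnion fun q _ => hK.image (continuous_const_mul _)).inv, fun g => ?_⟩
    obtain ⟨q, hq, c, hc, hcg⟩ := mem_iUnion₂.1 (ht (mem_univ ((g⁻¹ : G) : G ⧸ Γ)))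
    have hmem : c⁻¹ * g⁻¹ ∈ Γ := QuotientGroup.eq.1 hcg
    refine ⟨⟨c⁻¹ * g⁻¹, hΓΛ hmem⟩, Subgroup.mem_subgroupOf.2 hmem, ?_⟩
    rw [Subgroup.coe_subtype, inv_mul_cancel_right, Set.inv_mem_inv]
    exact mem_iUnion₂.2 ⟨q, hq, hc⟩

theorem Subgroup.commensurable_map_subtype (hΓΛ : Γ ≤ Λ) {N : Subgroup Λ}
    (hN : N ≤ Γ.subgroupOf Λ) (hi : N.relIndex (Γ.subgroupOf Λ) ≠ 0) :
    Subgroup.Commensurable (N.map Λ.subtype) Γ := by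
  have hmap : (Γ.subgroupOf Λ).map Λ.subtype = Γ := Subgroup.map_subgroupOf_eq_of_le hΓΛ
  have hle : N.map Λ.subtype ≤ Γ := hmap ▸ Subgroup.map_mono hN
  refine ⟨?_, ?_⟩
  · rw [← hmap, Subgroup.relIndex_map_map_of_injective _ _ Λ.subtype_injective]
    exact hi
  · rw [Subgroup.relIndex_eq_one.2 hle]
    exact one_ne_zero

theorem Subgroup.relIndex_map_conj_ne_zero (hΓΛ : Γ ≤ Λ)
    (hΛ : Λ ≤ Subgroup.Commensurable.commensurator Γ) (a : Λ) :
    ((Γ.subgroupOf Λ).map (MulAut.conj a).toMonoidHom).relIndex (Γ.subgroupOf Λ) ≠ 0 := by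
  have h := (Subgroup.Commensurable.commensurator_mem_iff _ _).1 (hΛ a.2)
  have hmap : (Γ.subgroupOf Λ).map Λ.subtype = Γ := Subgroup.map_subgroupOf_eq_of_le hΓΛ
  have hconj : ((Γ.subgroupOf Λ).map (MulAut.conj a).toMonoidHom).map Λ.subtype =
      ConjAct.toConjAct (a : G) • Γ := by
    ext g
    rw [Subgroup.mem_smul_pointwise_iff_exists]
    constructor
    · rintro ⟨_, ⟨n, hn, rfl⟩, rfl⟩
      exact ⟨n, Subgroup.mem_subgroupOf.1 hn, by simp [ConjAct.toConjAct_smul]⟩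
    · rintro ⟨n, hn, rfl⟩
      exact ⟨_, ⟨⟨n, hΓΛ hn⟩, Subgroup.mem_subgroupOf.2 hn, rfl⟩,
        by simp [ConjAct.toConjAct_smul]⟩
  rw [← Subgroup.relIndex_map_map_of_injective _ _ Λ.subtype_injective, hconj, hmap]
  exact h.1

end Subgroups

theorem mainTheorem4
    {G : Type*} [Group G] [TopologicalSpace G] [IsTopologicalGroup G] [LocallyCompactSpace G]
    [T2Space G] (hG : IsCompactlyGeneratedGroup G)
    (Γ : Subgroup G) (hΓ : IsCocompactLattice Γ)
    (Λ : Subgroup G) (hΓΛ : Γ ≤ Λ) (hΛcomm : Λ ≤ Subgroup.Commensurable.commensurator Γ)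
    (hΛdense : Dense (Λ : Set G))
    {X : Type*} [MetricSpace X] [CompleteSpace X] (hX : IsBNPC X) (hUC : IsUniformlyConvexSpace X)
    (α : Λ →* (X ≃ᵢ X))
    (hdisp : ∀ Γ₀ : Subgroup Λ, Subgroup.Commensurable (Γ₀.map Λ.subtype) Γ →
      ∀ S : Finset Λ, Subgroup.closure (S : Set Λ) = Γ₀ → DisplacementTendsToInfinity α S)
    (hpar : ∀ Γ₀ : Subgroup Λ, Subgroup.Commensurable (Γ₀.map Λ.subtype) Γ →
      HasNoParallelOrbits α Γ₀)
    (hmin : IsCMinimal α) :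
    ∃! ρ : G →* (X ≃ᵢ X),
      Continuous (fun p : G × X => ρ p.1 p.2) ∧ ∀ (l : Λ) (x : X), ρ (l : G) x = α l x := by
  have horbit : ∀ x, Tendsto (fun l => α l x) (comap Λ.subtype (𝓝 1)) (𝓝 x) := by
    intro x
    have : Nonempty X := ⟨x⟩
    have := hG.sigmaCompactSpace
    borelize G
    let ν : MeasureTheory.Measure G := MeasureTheory.Measure.haar
    obtain ⟨φ, hφ, heq⟩ := (hΓ.isDiscreteCocompact hΓΛ).exists_commensurator_equivariant
      (ν := ν) (α := α) hG hX hUC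
      (fun N hN hi => hdisp N (Subgroup.commensurable_map_subtype hΓΛ hN hi))
      (fun N hN hi => hpar N (Subgroup.commensurable_map_subtype hΓΛ hN hi))
      (Subgroup.relIndex_map_conj_ne_zero hΓΛ hΛcomm)
    obtain ⟨g, hg⟩ := (hφ.ae_measure_preimage_ne_zero ν).exists
    exact hmin.tendsto_orbit hX (tendsto_orbit_of_measure_preimage_ne_zero hφ heq hg) x
  obtain ⟨ρ, hρ, hρα⟩ := exists_continuous_extension_action hΛdense horbit
  refine ⟨ρ, ⟨hρ, hρα⟩, fun ρ' ⟨hρ', hρα'⟩ => MonoidHom.ext fun g => IsometryEquiv.ext fun x => ?_⟩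
  have hcont : ∀ {σ : G →* (X ≃ᵢ X)}, Continuous (fun p : G × X => σ p.1 p.2) →
      Continuous fun g => σ g x := fun h => h.comp (by fun_prop : Continuous fun g : G => (g, x))
  refine congrFun ((hcont hρ').ext_on hΛdense (hcont hρ) fun l hl => ?_) g
  exact (hρα' ⟨l, hl⟩ x).trans (hρα ⟨l, hl⟩ x).symm
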